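/- Let $\mathcal P$ be a finite abstract simplicial complex on a linearly ordered vertex set, with $N$ simplices in total (of all orders), each oriented by the vertex order. Let $\mathbf B_k$ be its incidence matrices: the entry of $\mathbf B_k$ at a $(k-1)$-simplex $\sigma$ and a $k$-simplex $\tau$ is $(-1)^i$ if $\sigma$ is obtained from $\tau$ by deleting its $i$-th vertex ($0\le i\le k$), and $0$ otherwise. Let $\mathbf D\in\mathbb R^{N\times N}$ be the Dirac operator, i.e. the symmetric block matrix, with blocks indexed by the orders of simplices, whose $(k-1,k)$ block is $\mathbf B_k$, whose $(k,k-1)$ block is $\mathbf B_k^\top$, and whose other blocks are $0$. Let $\mathbf U_{\mathcal P}\in\mathbb R^{N\times N}$ be an orthogonal matrix whose columns are eigenvectors of $\mathbf D$. Let $\mathbf U_{\mathcal P\Delta}$ consist of an arbitrary nonempty set of $N_{\mathcal P\Delta}$ of these columns (for instance those spanning the gradient, curl or harmonic Dirac subspace, or a combination of them), and let $\mathbf U_{\mathcal P\overline\Delta}$ consist of the remaining columns. Write $\operatorname{span}(\cdot)$ for the column space. For an $R$-dimensional subspace $\mathcal S$ of $\mathbb R^N$, $R\ge 1$, with orthogonal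 projection $\boldsymbol P_{\mathcal S}$, let $\mu(\mathcal S)=\frac NR\max_j\|\boldsymbol P_{\mathcal S}\boldsymbol e_j\|_2^2$ be its coherence, where $\boldsymbol e_1,\dots,\boldsymbol e_N$ is the standard basis, and for a vector $\boldsymbol v\neq 0$ let $\mu(\boldsymbol v)=\mu(\operatorname{span}\{\boldsymbol v\})$. Put $\mu=\mu(\operatorname{span}(\mathbf U_{\mathcal P\Delta}))$. Let $\boldsymbol x=\boldsymbol x_\Delta+\boldsymbol x_{\overline\Delta}\in\mathbb R^N$ be a fixed signal with $\boldsymbol x_\Delta\in\operatorname{span}(\mathbf U_{\mathcal P\Delta})$ and $\boldsymbol x_{\overline\Delta}\in\operatorname{span}(\mathbf U_{\mathcal P\overline\Delta})$. Let $\boldsymbol\Theta\in\{0,1\}^{N_o\times N}$ be a random sampling matrix with exactly one $1$ per row, the $N_o$ selected positions being drawn uniformly at random from the $N$ positions, either with replacement or without replacement (in the latter case $N_o\le N$). Let $\boldsymbol P_\Delta$ be the orthogonal projection of $\mathbb R^N$ onto $\operatorname{span}(\mathbf U_{\mathcal P\Delta})$ and $\boldsymbol P_{\Delta\Theta}$ the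 orthogonal projection of $\mathbb R^{N_o}$ onto $\operatorname{span}(\boldsymbol\Theta\mathbf U_{\mathcal P\Delta})$. Let $\epsilon>0$ and assume $N_o\ge\frac83 N_{\mathcal P\Delta}\,\mu\log\frac{2N_{\mathcal P\Delta}}{\epsilon}$. Put $$\delta=\sqrt{\tfrac{8N_{\mathcal P\Delta}\mu}{3N_o}\log\tfrac{2N_{\mathcal P\Delta}}{\epsilon}},\quad \gamma=\sqrt{2\mu(\boldsymbol x_{\overline\Delta})\log\tfrac1\epsilon},\quad \beta=\sqrt{\tfrac{2\mu(\boldsymbol x_{\overline\Delta})^2}{N_o}\log\tfrac1\epsilon},\quad \alpha=\frac{N_o(1-\beta)-N_{\mathcal P\Delta}\,\mu\,\frac{(1+\gamma)^2}{1-\delta}}{N}.$$ Then, with probability at least $1-4\epsilon$ over the choice of $\boldsymbol\Theta$, $$\alpha\,\|\boldsymbol x-\boldsymbol P_\Delta\boldsymbol x\|_2^2\;\le\;\|\boldsymbol\Theta\boldsymbol x-\boldsymbol P_{\Delta\Theta}\boldsymbol\Theta\boldsymbol x\|_2^2\;\le\;(1+\beta)\frac{N_o}{N}\,\|\boldsymbol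 x-\boldsymbol P_\Delta\boldsymbol x\|_2^2 .$$ Conventions: if the assumption on $N_o$ holds with equality, then $\delta=1$, $\alpha$ is read as $-\infty$, and only the upper bound is claimed; if $\boldsymbol x_{\overline\Delta}=0$, then $\mu(\boldsymbol x_{\overline\Delta})$ is read as $0$, and all three quantities vanish. For $\epsilon\ge\frac14$ the assertion is void. -/

import Mathlib

open MeasureTheory ProbabilityTheory

noncomputable section

namespace TopologicalDetector

/-- The simplices (of all orders) of a simplicial complex; signals on the complex are real vectors
indexed by them. -/
def Simplex {V : Type*} (K : AbstractSimplicialComplex V) : Type _ :=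
  {s : Finset V // s ∈ K.faces}

instance {V : Type*} [Fintype V] (K : AbstractSimplicialComplex V) : Fintype (Simplex K) := by
  classical
  exact @Fintype.ofFinite _ (inferInstanceAs (Finite {s : Finset V // s ∈ K.faces}))

instance {V : Type*} [DecidableEq V] (K : AbstractSimplicialComplex V) :
    DecidableEq (Simplex K) :=
  inferInstanceAs (DecidableEq {s : Finset V // s ∈ K.faces})

instance {V : Type*} (K : AbstractSimplicialComplex V) : MeasurableSpace (Simplex K) := ⊤

section Dirac

variable {V : Type*} [Fintype V] [LinearOrder V] (K : AbstractSimplicialComplex V)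

/-- The incidence matrices `B_k` of all orders, collected in one matrix indexed by all simplices.
With simplices oriented by the order of the vertices, the entry at `(σ, τ)` is `(-1) ^ i` if `σ`
arises from `τ` by deleting its `i`-th vertex (counted from `0`), and `0` otherwise. The block with
rows in order `k - 1` and columns in order `k` is `B_k`; all other blocks vanish. -/
def incidence : Matrix (Simplex K) (Simplex K) ℝ :=
  Matrix.of fun σ τ =>
    ∑ v ∈ τ.1, if σ.1 = τ.1.erase v then (-1 : ℝ) ^ (τ.1.filter (· < v)).card else 0

/-- The Dirac operator: the symmetric block tridiagonal matrix with `B_k` above and `B_kᵀ` below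
the zero diagonal blocks. -/
def dirac : Matrix (Simplex K) (Simplex K) ℝ :=
  incidence K + (incidence K).transpose

/-- `U` is a (square) matrix whose columns are orthonormal eigenvectors of the Dirac operator,
`D = U Λ Uᵀ` with `Λ = diag(ev)`. -/
structure IsDiracEigenbasis
    (U : Matrix (Simplex K) (Fin (Fintype.card (Simplex K))) ℝ)
    (ev : Fin (Fintype.card (Simplex K)) → ℝ) : Prop where
  orthonormal : U.transpose * U = 1
  eigen : dirac K * U = U * Matrix.diagonal ev

end Dirac

/-- The submatrix of the columns of `U` with index in `Δ`. -/
def columns {m n : Type*} (U : Matrix m n ℝ) (Δ : Finset n) : Matrix m Δ ℝ :=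
  U.submatrix id Subtype.val

/-- The column space of a matrix, as a subspace of Euclidean space. -/
def colSpan {m n : Type*} (A : Matrix m n ℝ) : Submodule ℝ (EuclideanSpace ℝ m) :=
  Submodule.span ℝ (Set.range fun j => WithLp.toLp 2 fun i => A i j)

/-- The coherence `(N / R) * max_j ‖P_S e_j‖²` of an `R`-dimensional subspace `S` of `ℝ^N`. -/
def coherence {m : Type*} [Fintype m] [DecidableEq m]
    (S : Submodule ℝ (EuclideanSpace ℝ m)) : ℝ :=
  (Fintype.card m : ℝ) / (Module.finrank ℝ S : ℝ) *
    ⨆ j : m, ‖S.starProjection (EuclideanSpace.single j (1 : ℝ))‖ ^ 2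

/-- The coherence of a vector: that of the line it spans. -/
def vecCoherence {m : Type*} [Fintype m] [DecidableEq m] (v : EuclideanSpace ℝ m) : ℝ :=
  coherence (Submodule.span ℝ {v})

/-- The `0`-`1` sampling matrix with exactly one `1` per row, the one in row `i` being in
column `s i`. -/
def samplingMatrix {m : Type*} [DecidableEq m] {n : ℕ} (s : Fin n → m) : Matrix (Fin n) m ℝ :=
  Matrix.of fun i j => if s i = j then 1 else 0

/-- The sampled signal `Θ x`. -/
def sample {m : Type*} [Fintype m] {n : ℕ} (Θ : Matrix (Fin n) m ℝ) (x : EuclideanSpace ℝ m) :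
    EuclideanSpace ℝ (Fin n) :=
  WithLp.toLp 2 (Θ.mulVec x.ofLp)

/-- The energy `‖x - P_S x‖²` of the residual of `x` after orthogonal projection onto `S`. -/
def residual {m : Type*} [Fintype m] (S : Submodule ℝ (EuclideanSpace ℝ m))
    (x : EuclideanSpace ℝ m) : ℝ :=
  ‖x - S.starProjection x‖ ^ 2

/-- The random positions `s : Ω → Fin n → m` are drawn uniformly at random, either with
replacement (uniform among all sequences of length `n`) or without replacement (uniform among
the sequences of `n` distinct positions). -/
def IsUniformSampling {Ω m : Type*} [MeasurableSpace Ω] [MeasurableSpace m] {n : ℕ}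
    (s : Ω → Fin n → m) (P : Measure Ω) : Prop :=
  HasLaw s (uniformOn Set.univ) P ∨ HasLaw s (uniformOn {t | Function.Injective t}) P

end TopologicalDetector

end

/-! Write `W` for the selected columns, `r` for their number, `n` for the number of samples and `y`
for the component of the signal in the complementary span. The component in the span of `W` is
removed by both residuals, and `Wᵀ y = 0`, so the full residual is `‖y‖²` and the sampled one is
that of `Θy`.

The sampled residual is at most `‖Θy‖²`. It is at least `‖Θy‖² - ‖(ΘW)ᵀΘy‖² / l` whenever `(ΘW)ᵀ(ΘW)
≥ l` (`le_residual_sample`). Hence both bounds hold outside four events: the energy `‖Θy‖²` exceeds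
`1 + β` times its mean, or falls below `1 - β` times it; the cross term `‖(ΘW)ᵀΘy‖` exceeds `1 + γ`
times a bound on its mean; or the least eigenvalue of `(ΘW)ᵀ(ΘW)` falls below `(1 - δ) n / N`. Each
has probability at most `ε`. Coherence enters as a uniform bound on the rows of `W` and on the
entries of `y`.

Energy and cross term are controlled by McDiarmid's inequality (`card_filter_convex_ge_le`), the
eigenvalue by a matrix Chernoff bound (`card_filter_quadForm_lt_le`). Every tail bound is Markov's
inequality for a convex function of a sum of sampled terms, so Hoeffding's comparison
(`sum_injective_convex_le`) carries it over to sampling without replacement. The matrix bound needs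
neither Lieb's theorem nor the Golden-Thompson inequality: all summands have rank one, and the
decrease of `tr exp` along a rank-one direction is estimated directly
(`trace_exp_sub_vecMulVec_le`). -/

namespace TopologicalDetector

/-! ### Scalar concentration: bounded differences for independent uniform positions. -/

section Concentration

variable {m : Type*} [Fintype m]

/-- A sum over sequences of length `n + 1`, split according to the first entry. -/
lemma sum_seq_succ {n : ℕ} (g : (Fin (n + 1) → m) → ℝ) :
    ∑ t, g t = ∑ a, ∑ t : Fin n → m, g (Fin.cons a t) := by
  rw [← (Fin.consEquiv (fun _ => m)).sum_comp, Fintype.sum_prod_type]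
  rfl

/-- Hoeffding's lemma for the uniform distribution on a finite type. -/
lemma sum_exp_le_of_sub_le [Nonempty m] (F : m → ℝ) (c l : ℝ) (hF : ∀ a b, F a - F b ≤ c) :
    ∑ a, Real.exp (l * F a) ≤
      Fintype.card m * Real.exp (l * ((∑ a, F a) / Fintype.card m) + l ^ 2 * c ^ 2 / 8) := by
  let _ : MeasurableSpace m := ⊤
  set N : ℝ := (Fintype.card m : ℝ) with hN
  have hN0 : 0 < N := by rw [hN]; exact_mod_cast Fintype.card_pos
  set ν : Measure m := (PMF.uniformOfFintype m).toMeasure with hν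
  have hintegral (g : m → ℝ) : ∫ a, g a ∂ν = (∑ a, g a) / N := by
    rw [hν, PMF.integral_eq_sum, Finset.sum_div]
    refine Finset.sum_congr rfl fun a _ => ?_
    simp [PMF.uniformOfFintype_apply, hN, div_eq_inv_mul]
  -- Starting at its minimum, `F` stays in an interval of length `c`.
  obtain ⟨a₀, ha₀⟩ := Finite.exists_min F
  have h := (hasSubgaussianMGF_of_mem_Icc (μ := ν) (X := F) (a := F a₀) (b := F a₀ + c)
    (measurable_from_top.aemeasurable)
    (Filter.Eventually.of_forall fun a => ⟨ha₀ a, by linarith [hF a a₀]⟩)).mgf_le l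
  rw [mgf, hintegral, hintegral, div_le_iff₀ hN0] at h
  have e1 : ∑ a, Real.exp (l * F a) =
      Real.exp (l * ((∑ a, F a) / N)) * ∑ a, Real.exp (l * (F a - (∑ a, F a) / N)) := by
    rw [Finset.mul_sum]
    refine Finset.sum_congr rfl fun a _ => ?_
    rw [← Real.exp_add]; ring_nf
  have e2 : (((‖F a₀ + c - F a₀‖₊ / 2) ^ 2 : NNReal) : ℝ) * l ^ 2 / 2 = l ^ 2 * c ^ 2 / 8 := by
    simp only [add_sub_cancel_left, NNReal.coe_pow, NNReal.coe_div, coe_nnnorm, Real.norm_eq_abs,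
      NNReal.coe_ofNat, div_pow, sq_abs]
    ring
  rw [e2] at h
  rw [e1, Real.exp_add]
  calc _ ≤ Real.exp (l * ((∑ a, F a) / N)) * (Real.exp (l ^ 2 * c ^ 2 / 8) * N) := by gcongr
    _ = _ := by ring

/-- McDiarmid's bound on the moment generating function of a function with bounded differences of
independent uniform positions. -/
lemma sum_exp_le_of_boundedDifferences [Nonempty m] (c l : ℝ) {n : ℕ} (f : (Fin n → m) → ℝ)
    (hf : ∀ t i a, f t - f (Function.update t i a) ≤ c) :
    ∑ t, Real.exp (l * f t) ≤ (Fintype.card m : ℝ) ^ n *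
      Real.exp (l * ((∑ t, f t) / (Fintype.card m : ℝ) ^ n) + n * (l ^ 2 * c ^ 2 / 8)) := by
  set N : ℝ := (Fintype.card m : ℝ) with hN
  have hN0 : 0 < N := by rw [hN]; exact_mod_cast Fintype.card_pos
  induction n with
  | zero => simp
  | succ n ih =>
    -- The conditional mean given the first position: Hoeffding's lemma handles its fluctuation, the
    -- induction hypothesis that of the remaining positions.
    set F : m → ℝ := fun a => (∑ t : Fin n → m, f (Fin.cons a t)) / N ^ n with hF
    have hFc : ∀ a b, F a - F b ≤ c := by
      intro a b
      simp only [hF]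
      rw [← sub_div, ← Finset.sum_sub_distrib, div_le_iff₀ (by positivity)]
      calc _ ≤ ∑ _t : Fin n → m, c := by
            refine Finset.sum_le_sum fun t _ => ?_
            have := hf (Fin.cons a t) 0 b
            rwa [Fin.update_cons_zero] at this
        _ = c * N ^ n := by simp [hN, mul_comm]
    rw [sum_seq_succ, sum_seq_succ]
    have hin : ∀ a, ∑ t : Fin n → m, Real.exp (l * f (Fin.cons a t)) ≤
        N ^ n * Real.exp (n * (l ^ 2 * c ^ 2 / 8)) * Real.exp (l * F a) := by
      intro a
      have := ih (fun t => f (Fin.cons a t)) (by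
        intro t i b
        have := hf (Fin.cons a t) i.succ b
        rwa [← Fin.cons_update] at this)
      rw [Real.exp_add] at this
      calc _ ≤ _ := this
        _ = _ := by ring
    calc _ ≤ ∑ a, N ^ n * Real.exp (n * (l ^ 2 * c ^ 2 / 8)) * Real.exp (l * F a) :=
          Finset.sum_le_sum fun a _ => hin a
      _ = N ^ n * Real.exp (n * (l ^ 2 * c ^ 2 / 8)) * ∑ a, Real.exp (l * F a) := by
          rw [Finset.mul_sum]
      _ ≤ N ^ n * Real.exp (n * (l ^ 2 * c ^ 2 / 8)) *
          (N * Real.exp (l * ((∑ a, F a) / N) + l ^ 2 * c ^ 2 / 8)) := by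
          gcongr; exact sum_exp_le_of_sub_le F c l hFc
      _ = N ^ (n + 1) * (Real.exp (n * (l ^ 2 * c ^ 2 / 8)) *
          Real.exp (l * ((∑ a, F a) / N) + l ^ 2 * c ^ 2 / 8)) := by ring
      _ = _ := by
          rw [← Real.exp_add]
          congr 2
          simp only [hF]
          rw [← Finset.sum_div]
          push_cast
          field_simp
          ring

/-! ### Comparison of sampling without and with replacement. -/

variable {E : Type*} [AddCommGroup E] [Module ℝ E]

/-- Averaging over all permutations of the positions, sequences of distinct positions give the
smallest value of a convex function of the sum. -/
lemma exists_injective_sum_perm_le [DecidableEq m] {n : ℕ} (hn : n ≤ Fintype.card m) (Z : m → E)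
    {C : Set E} {φ : E → ℝ} (hφ : ConvexOn ℝ C φ) (hC : ∀ t : Fin n → m, ∑ i, Z (t i) ∈ C)
    (t : Fin n → m) :
    ∃ u : Fin n → m, Function.Injective u ∧
      ∑ σ : Equiv.Perm m, φ (∑ i, Z (σ (u i))) ≤ ∑ σ : Equiv.Perm m, φ (∑ i, Z (σ (t i))) := by
  -- The witness `u` enumerates `n` distinct positions containing all values of `t`, so `t = u ∘ r`.
  -- Averaging `u ∘ ρ ∘ r` over permutations `ρ` of the indices spreads each of the `n` terms evenly
  -- over `u`; the mean of the sums is thus the sum along `u`, and Jensen applies.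
  obtain ⟨T, hT, hTc⟩ := Finset.exists_superset_card_eq (s := Finset.univ.image t) (n := n)
    (Finset.card_image_le.trans (by simp)) hn
  let e : Fin n ≃ T := (T.equivFinOfCardEq hTc).symm
  let u : Fin n ↪ m := e.toEmbedding.trans (Function.Embedding.subtype _)
  have hr : ∀ i, ∃ k, u k = t i := fun i =>
    ⟨e.symm ⟨t i, hT (Finset.mem_image_of_mem t (Finset.mem_univ i))⟩, by simp [u]⟩
  choose r hr using hr
  refine ⟨u, u.injective, ?_⟩
  set P : ℝ := (Fintype.card (Equiv.Perm (Fin n)) : ℝ) with hP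
  have hP0 : 0 < P := by rw [hP]; exact_mod_cast Fintype.card_pos
  have hmean : ∀ (g : Fin n → E) (j : Fin n), (n : ℝ) • ∑ ρ : Equiv.Perm (Fin n), g (ρ j) =
      P • ∑ k, g k := by
    intro g j
    have hind : ∀ k, ∑ ρ : Equiv.Perm (Fin n), g (ρ j) = ∑ ρ : Equiv.Perm (Fin n), g (ρ k) := by
      intro k
      rw [← Equiv.sum_comp (Equiv.mulRight (Equiv.swap j k))]
      simp
    have h1 : ∑ k, ∑ ρ : Equiv.Perm (Fin n), g (ρ k) = P • ∑ k, g k := by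
      rw [Finset.sum_comm, Finset.sum_congr rfl fun ρ _ => Equiv.sum_comp ρ g]
      simp [hP, Nat.cast_smul_eq_nsmul]
    rw [← h1, Finset.sum_congr rfl fun k _ => (hind k).symm]
    simp [Nat.cast_smul_eq_nsmul]
  have hkey : ∀ σ : Equiv.Perm m, φ (∑ i, Z (σ (u i))) ≤
      ∑ ρ : Equiv.Perm (Fin n), P⁻¹ * φ (∑ i, Z (σ (u (ρ (r i))))) := by
    intro σ
    have hE : ∑ i, Z (σ (u i)) = ∑ ρ : Equiv.Perm (Fin n), P⁻¹ • ∑ i, Z (σ (u (ρ (r i)))) := by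
      rw [← Finset.smul_sum, Finset.sum_comm]
      rcases Nat.eq_zero_or_pos n with h0 | hpos
      · subst h0; simp
      have hn0 : (n : ℝ) ≠ 0 := by positivity
      have : ∀ i, ∑ ρ : Equiv.Perm (Fin n), Z (σ (u (ρ (r i)))) =
          (n : ℝ)⁻¹ • P • ∑ k, Z (σ (u k)) := by
        intro i
        rw [← hmean (fun k => Z (σ (u k))) (r i), inv_smul_smul₀ hn0]
      rw [Finset.sum_congr rfl fun i _ => this i, Finset.sum_const, Finset.card_univ,
        Fintype.card_fin, ← Nat.cast_smul_eq_nsmul ℝ, smul_inv_smul₀ hn0, inv_smul_smul₀ hP0.ne']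
    rw [hE]
    refine hφ.map_sum_le (fun _ _ => by positivity) ?_ (fun ρ _ => hC fun i => σ (u (ρ (r i))))
    simp [hP]
  calc _ ≤ ∑ σ : Equiv.Perm m, ∑ ρ : Equiv.Perm (Fin n), P⁻¹ * φ (∑ i, Z (σ (u (ρ (r i))))) :=
        Finset.sum_le_sum fun σ _ => hkey σ
    _ = ∑ ρ : Equiv.Perm (Fin n), P⁻¹ * ∑ σ : Equiv.Perm m, φ (∑ i, Z (σ (t i))) := by
        rw [Finset.sum_comm]
        refine Finset.sum_congr rfl fun ρ _ => ?_
        rw [← Finset.mul_sum]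
        congr 1
        -- Transported along `u`, `ρ` becomes a permutation of the positions and is absorbed into
        -- the sum over `σ`.
        rw [← Equiv.sum_comp (Equiv.mulRight (ρ.viaEmbedding u))
          (fun σ : Equiv.Perm m => φ (∑ i, Z (σ (t i))))]
        refine Finset.sum_congr rfl fun σ _ => ?_
        simp [← hr, Equiv.Perm.viaEmbedding_apply]
    _ = _ := by
        rw [Finset.sum_const, Finset.card_univ, nsmul_eq_mul, ← mul_assoc, ← hP,
          mul_inv_cancel₀ hP0.ne', one_mul]

/-- Hoeffding's comparison: the mean of a convex function of a sum sampled without replacement is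
at most its mean for sampling with replacement. -/
lemma sum_injective_convex_le [DecidableEq m] {n : ℕ} (hn : n ≤ Fintype.card m) (Z : m → E)
    {C : Set E} {φ : E → ℝ} (hφ : ConvexOn ℝ C φ) (hC : ∀ t : Fin n → m, ∑ i, Z (t i) ∈ C)
    (S : Finset (Fin n → m)) (hS : ∀ t, t ∈ S ↔ Function.Injective t) :
    (Fintype.card m : ℝ) ^ n * ∑ t ∈ S, φ (∑ i, Z (t i)) ≤
      S.card * ∑ t : Fin n → m, φ (∑ i, Z (t i)) := by
  -- Symmetrization: `A` takes one value on all injective sequences, since permutations act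
  -- transitively on them, and this value is minimal by the preceding lemma. Both sides are sums of
  -- `A` up to a common factor.
  set A : (Fin n → m) → ℝ := fun t => ∑ σ : Equiv.Perm m, φ (∑ i, Z (σ (t i))) with hA
  have hAeq : ∀ u v : Fin n → m, Function.Injective u → Function.Injective v → A u = A v := by
    intro u v hu hv
    have : MulAction.IsPretransitive (Equiv.Perm m) (Fin n ↪ m) :=
      Equiv.Perm.isMultiplyPretransitive m n
    obtain ⟨τ, hτ⟩ := MulAction.exists_smul_eq (Equiv.Perm m)
      (⟨u, hu⟩ : Fin n ↪ m) (⟨v, hv⟩ : Fin n ↪ m)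
    have hτ' : ∀ i, τ (u i) = v i := fun i => DFunLike.congr_fun hτ i
    simp only [hA]
    rw [← Equiv.sum_comp (Equiv.mulRight τ)]
    simp [hτ']
  obtain ⟨u₀⟩ : Nonempty (Fin n ↪ m) := Function.Embedding.nonempty_of_card_le (by simpa using hn)
  set F : ℝ := (Fintype.card (Equiv.Perm m) : ℝ) with hF
  have hF0 : 0 < F := by rw [hF]; exact_mod_cast Fintype.card_pos
  have h1 : F * ∑ t ∈ S, φ (∑ i, Z (t i)) = S.card * A u₀ := by
    have : ∀ σ : Equiv.Perm m,
        ∑ t ∈ S, φ (∑ i, Z (σ (t i))) = ∑ t ∈ S, φ (∑ i, Z (t i)) := by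
      intro σ
      refine Finset.sum_equiv (Equiv.arrowCongr (Equiv.refl _) σ) ?_ ?_
      · intro t
        rw [hS, hS]
        exact (σ.injective.of_comp_iff t).symm
      · intro t _; rfl
    calc F * ∑ t ∈ S, φ (∑ i, Z (t i))
        = ∑ σ : Equiv.Perm m, ∑ t ∈ S, φ (∑ i, Z (σ (t i))) := by
          rw [Finset.sum_congr rfl fun σ _ => this σ]; simp [hF]
      _ = ∑ t ∈ S, A t := Finset.sum_comm
      _ = ∑ t ∈ S, A u₀ :=
          Finset.sum_congr rfl fun t ht => hAeq t u₀ ((hS t).1 ht) u₀.injective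
      _ = _ := by simp
  have h2 : (Fintype.card m : ℝ) ^ n * A u₀ ≤ F * ∑ t : Fin n → m, φ (∑ i, Z (t i)) := by
    have : ∀ σ : Equiv.Perm m,
        ∑ t : Fin n → m, φ (∑ i, Z (σ (t i))) = ∑ t : Fin n → m, φ (∑ i, Z (t i)) := by
      intro σ
      exact Fintype.sum_equiv (Equiv.arrowCongr (Equiv.refl _) σ) _ _ fun t => rfl
    calc (Fintype.card m : ℝ) ^ n * A u₀ = ∑ _t : Fin n → m, A u₀ := by simp
      _ ≤ ∑ t, A t := by
          refine Finset.sum_le_sum fun t _ => ?_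
          obtain ⟨u, hu, h⟩ := exists_injective_sum_perm_le hn Z hφ hC t
          rw [hAeq u₀ u u₀.injective hu]
          exact h
      _ = ∑ σ : Equiv.Perm m, ∑ t : Fin n → m, φ (∑ i, Z (σ (t i))) := Finset.sum_comm
      _ = _ := by rw [Finset.sum_congr rfl fun σ _ => this σ]; simp [hF]
  refine le_of_mul_le_mul_left ?_ hF0
  calc F * ((Fintype.card m : ℝ) ^ n * ∑ t ∈ S, φ (∑ i, Z (t i)))
      = S.card * ((Fintype.card m : ℝ) ^ n * A u₀) := by rw [mul_left_comm, h1]; ring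
    _ ≤ S.card * (F * ∑ t : Fin n → m, φ (∑ i, Z (t i))) := by gcongr
    _ = _ := by ring

/-- The sample spaces of sampling with and without replacement. -/
def IsSampleSpace {n : ℕ} (S : Finset (Fin n → m)) : Prop :=
  S = Finset.univ ∨ n ≤ Fintype.card m ∧ ∀ t, t ∈ S ↔ Function.Injective t

lemma IsSampleSpace.sum_convex_le [DecidableEq m] {n : ℕ} {S : Finset (Fin n → m)}
    (hS : IsSampleSpace S) (Z : m → E) {C : Set E} {φ : E → ℝ} (hφ : ConvexOn ℝ C φ)
    (hC : ∀ t : Fin n → m, ∑ i, Z (t i) ∈ C) :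
    (Fintype.card m : ℝ) ^ n * ∑ t ∈ S, φ (∑ i, Z (t i)) ≤
      S.card * ∑ t : Fin n → m, φ (∑ i, Z (t i)) := by
  rcases hS with rfl | ⟨hn, hS⟩
  · simp
  · exact sum_injective_convex_le hn Z hφ hC S hS

/-- Markov's inequality for a convex function of the sampled sum. -/
lemma IsSampleSpace.card_filter_le [DecidableEq m] [Nonempty m] {n : ℕ} {S : Finset (Fin n → m)}
    (hS : IsSampleSpace S) (Z : m → E) {C : Set E} {φ : E → ℝ} (hφ : ConvexOn ℝ C φ)
    (hC : ∀ t : Fin n → m, ∑ i, Z (t i) ∈ C) (hφ0 : ∀ t : Fin n → m, 0 ≤ φ (∑ i, Z (t i)))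
    {B a p : ℝ} (ha : 0 < a) (hB : ∑ t : Fin n → m, φ (∑ i, Z (t i)) ≤ (Fintype.card m : ℝ) ^ n * B)
    (hp : B ≤ p * a) (bad : (Fin n → m) → Prop) [DecidablePred bad]
    (hbad : ∀ t, bad t → a ≤ φ (∑ i, Z (t i))) :
    ((S.filter bad).card : ℝ) ≤ p * S.card := by
  have hN0 : 0 < (Fintype.card m : ℝ) ^ n := by
    have : 0 < (Fintype.card m : ℝ) := by exact_mod_cast Fintype.card_pos
    positivity
  have h1 := hS.sum_convex_le Z hφ hC
  have h2 : ((S.filter bad).card : ℝ) * a ≤ ∑ t ∈ S, φ (∑ i, Z (t i)) := by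
    calc ((S.filter bad).card : ℝ) * a = ∑ t ∈ S.filter bad, a := by simp
      _ ≤ ∑ t ∈ S.filter bad, φ (∑ i, Z (t i)) :=
          Finset.sum_le_sum fun t ht => hbad t (Finset.mem_filter.1 ht).2
      _ ≤ _ := Finset.sum_le_sum_of_subset_of_nonneg (Finset.filter_subset _ _)
          fun t _ _ => hφ0 t
  have h3 : ∑ t ∈ S, φ (∑ i, Z (t i)) ≤ S.card * B := by
    refine le_of_mul_le_mul_left ?_ hN0
    calc _ ≤ _ := h1
      _ ≤ S.card * ((Fintype.card m : ℝ) ^ n * B) := by gcongr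
      _ = _ := by ring
  refine le_of_mul_le_mul_right ?_ ha
  calc _ ≤ _ := h2.trans h3
    _ ≤ S.card * (p * a) := by gcongr
    _ = _ := by ring

/-- McDiarmid's inequality for a convex function of the sum of sampled vectors, for sampling with
or without replacement. -/
lemma IsSampleSpace.card_filter_convex_ge_le [DecidableEq m] [Nonempty m] {n : ℕ} (hn : 0 < n)
    {S : Finset (Fin n → m)} (hS : IsSampleSpace S) (Z : m → E) {h : E → ℝ}
    (hh : ConvexOn ℝ Set.univ h) {c : ℝ} (hc : 0 < c) (hZ : ∀ v a b, h (v + Z a) - h (v + Z b) ≤ c)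
    {M : ℝ} (hM : ∑ t : Fin n → m, h (∑ i, Z (t i)) ≤ (Fintype.card m : ℝ) ^ n * M)
    {r : ℝ} (hr : 0 ≤ r) (bad : (Fin n → m) → Prop) [DecidablePred bad]
    (hbad : ∀ t, bad t → M + r ≤ h (∑ i, Z (t i))) :
    ((S.filter bad).card : ℝ) ≤ Real.exp (-(2 * r ^ 2 / (n * c ^ 2))) * S.card := by
  -- The minimizer of `-l * r + n * l ^ 2 * c ^ 2 / 8`.
  set l : ℝ := 4 * r / (n * c ^ 2) with hl
  have hl0 : 0 ≤ l := by positivity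
  have hN0 : 0 < (Fintype.card m : ℝ) ^ n := by
    have : 0 < (Fintype.card m : ℝ) := by exact_mod_cast Fintype.card_pos
    positivity
  refine hS.card_filter_le Z (C := Set.univ) (φ := fun v => Real.exp (l * h v)) ?_ (by simp)
    (fun t => (Real.exp_pos _).le) (B := Real.exp (l * M + n * (l ^ 2 * c ^ 2 / 8)))
    (a := Real.exp (l * (M + r))) (Real.exp_pos _) ?_ ?_ bad ?_
  · refine ⟨convex_univ, fun x hx y hy a b ha hb hab => ?_⟩
    have h1 := mul_le_mul_of_nonneg_left (hh.2 hx hy ha hb hab) hl0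
    have h2 := convexOn_exp.2 (Set.mem_univ (l * h x)) (Set.mem_univ (l * h y)) ha hb hab
    refine (Real.exp_le_exp.2 (h1.trans_eq ?_)).trans h2
    simp only [smul_eq_mul]
    ring
  · refine (sum_exp_le_of_boundedDifferences c l (fun t => h (∑ i, Z (t i))) ?_).trans ?_
    · intro t i a
      have e1 : ∑ k, Z (t k) = ∑ k ∈ Finset.univ.erase i, Z (t k) + Z (t i) :=
        (Finset.sum_erase_add _ _ (Finset.mem_univ i)).symm
      have e2 : ∑ k, Z (Function.update t i a k) = ∑ k ∈ Finset.univ.erase i, Z (t k) + Z a := by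
        rw [← Finset.sum_erase_add _ _ (Finset.mem_univ i)]
        congr 1
        · refine Finset.sum_congr rfl fun k hk => ?_
          rw [Function.update_of_ne (Finset.ne_of_mem_erase hk)]
        · simp
      rw [e1, e2]
      exact hZ _ _ _
    · gcongr
      rwa [div_le_iff₀' hN0]
  · rw [← Real.exp_add]
    refine Real.exp_le_exp.2 (le_of_eq ?_)
    rw [hl]
    field_simp
    ring
  · intro t ht
    exact Real.exp_le_exp.2 (mul_le_mul_of_nonneg_left (hbad t ht) hl0)

end Concentration

/-! ### Trace of the matrix exponential and the matrix Chernoff bound. -/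

section TraceExp

open Matrix NormedSpace

variable {κ : Type*} [Fintype κ]

/-- The weighted Chebyshev sum inequality for similarly ordered sequences. -/
lemma weighted_chebyshev (w f g : κ → ℝ) (hw : ∀ i, 0 ≤ w i) (hfg : Monovary f g) :
    (∑ i, f i * w i) * (∑ i, g i * w i) ≤ (∑ i, w i) * ∑ i, f i * g i * w i := by
  have h : 0 ≤ ∑ i, ∑ j, w i * w j * ((f j - f i) * (g j - g i)) :=
    Finset.sum_nonneg fun i _ => Finset.sum_nonneg fun j _ =>
      mul_nonneg (mul_nonneg (hw i) (hw j)) (monovary_iff_forall_mul_nonneg.1 hfg i j)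
  have e : ∑ i, ∑ j, w i * w j * ((f j - f i) * (g j - g i)) =
      2 * ((∑ i, w i) * ∑ i, f i * g i * w i) - 2 * ((∑ i, f i * w i) * (∑ i, g i * w i)) := by
    have e1 : ∀ i j, w i * w j * ((f j - f i) * (g j - g i)) =
        w i * (f j * g j * w j) + (f i * g i * w i) * w j
          - ((f i * w i) * (g j * w j) + (g i * w i) * (f j * w j)) := fun i j => by ring
    simp_rw [e1, Finset.sum_sub_distrib, Finset.sum_add_distrib, ← Finset.mul_sum,
      ← Finset.sum_mul]
    ring
  linarith

lemma transpose_mul_mul_diag (Q A : Matrix κ κ ℝ) (j : κ) :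
    (Qᵀ * A * Q) j j = Qᵀ j ⬝ᵥ (A *ᵥ Qᵀ j) := by
  rw [Matrix.mul_assoc]
  rfl

lemma quadForm_vecMulVec (u v : κ → ℝ) : v ⬝ᵥ (vecMulVec u u *ᵥ v) = (v ⬝ᵥ u) ^ 2 := by
  rw [vecMulVec_mulVec]
  simp [dotProduct_smul, dotProduct_comm u v, sq]

lemma isHermitian_vecMulVec {ι : Type*} (u : ι → ℝ) : (vecMulVec u u).IsHermitian := by
  ext i j
  simp [vecMulVec_apply, mul_comm]

lemma hasSum_weighted_exp (d w : κ → ℝ) :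
    HasSum (fun k : ℕ => (∑ j, d j ^ k * w j) / k.factorial) (∑ j, Real.exp (d j) * w j) := by
  have : ∀ j, HasSum (fun k : ℕ => d j ^ k / k.factorial * w j) (Real.exp (d j) * w j) := by
    intro j
    rw [Real.exp_eq_exp_ℝ]
    exact (NormedSpace.expSeries_div_hasSum_exp (d j)).mul_right _
  convert hasSum_sum fun j (_ : j ∈ Finset.univ) => this j using 2 with k
  rw [Finset.sum_div]
  exact Finset.sum_congr rfl fun j _ => by ring

variable [DecidableEq κ]

/-- Spectral decomposition of the quadratic forms of the powers and the exponential of a symmetric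
matrix. -/
lemma exists_spectral_quadForm {A : Matrix κ κ ℝ} (hA : A.IsHermitian) :
    ∃ (Q : Matrix κ κ ℝ) (d : κ → ℝ), Qᵀ * Q = 1 ∧ Q * Qᵀ = 1 ∧ A = Q * diagonal d * Qᵀ ∧
      exp A = Q * diagonal (fun j => Real.exp (d j)) * Qᵀ := by
  set Q : Matrix κ κ ℝ := (hA.eigenvectorUnitary : Matrix κ κ ℝ) with hQ
  have h1 : Qᵀ * Q = 1 := by
    simpa [star_eq_conjTranspose] using Unitary.coe_star_mul_self hA.eigenvectorUnitary
  have h2 : Q * Qᵀ = 1 := by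
    simpa [star_eq_conjTranspose] using Unitary.coe_mul_star_self hA.eigenvectorUnitary
  have h3 : A = Q * diagonal hA.eigenvalues * Qᵀ := by
    have := hA.spectral_theorem
    rw [Unitary.conjStarAlgAut_apply] at this
    simpa [star_eq_conjTranspose] using! this
  have hinv : Q⁻¹ = Qᵀ := inv_eq_left_inv h1
  refine ⟨Q, hA.eigenvalues, h1, h2, h3, ?_⟩
  have hu : IsUnit Q := IsUnit.of_mul_eq_one Qᵀ h2
  conv_lhs => rw [h3, ← hinv, exp_conj Q _ hu, exp_diagonal, hinv]
  congr 3
  ext j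
  rw [Pi.coe_exp, Real.exp_eq_exp_ℝ]

lemma dotProduct_conj_diagonal (Q : Matrix κ κ ℝ) (d v : κ → ℝ) :
    v ⬝ᵥ ((Q * diagonal d * Qᵀ) *ᵥ v) = ∑ j, d j * ((Qᵀ *ᵥ v) j) ^ 2 := by
  rw [← mulVec_mulVec, ← mulVec_mulVec, dotProduct_mulVec, ← mulVec_transpose, dotProduct]
  refine Finset.sum_congr rfl fun j _ => ?_
  rw [mulVec_diagonal]
  ring

lemma sum_sq_transpose_mulVec {Q : Matrix κ κ ℝ} (hQ : Q * Qᵀ = 1) (v : κ → ℝ) :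
    ∑ j, ((Qᵀ *ᵥ v) j) ^ 2 = v ⬝ᵥ v := by
  have := dotProduct_conj_diagonal Q (fun _ => 1) v
  rw [diagonal_one, mul_one, hQ, one_mulVec] at this
  simpa using this.symm

lemma conj_diagonal_pow {Q : Matrix κ κ ℝ} (hQ : Qᵀ * Q = 1) (hQ' : Q * Qᵀ = 1) (d : κ → ℝ)
    (k : ℕ) : (Q * diagonal d * Qᵀ) ^ k = Q * diagonal (fun j => d j ^ k) * Qᵀ := by
  induction k with
  | zero => simp [hQ']
  | succ k ih =>
    rw [pow_succ, ih]
    calc _ = Q * diagonal (fun j => d j ^ k) * (Qᵀ * Q) * diagonal d * Qᵀ := by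
          simp only [Matrix.mul_assoc]
      _ = _ := by
          rw [hQ, Matrix.mul_one, Matrix.mul_assoc Q, diagonal_mul_diagonal]
          simp [pow_succ]

lemma trace_conj_diagonal {Q : Matrix κ κ ℝ} (hQ : Qᵀ * Q = 1) (d : κ → ℝ) :
    (Q * diagonal d * Qᵀ).trace = ∑ j, d j := by
  rw [trace_mul_comm, ← Matrix.mul_assoc, hQ, Matrix.one_mul, trace_diagonal]

/-- Jensen's inequality in an eigenbasis of `A`: the squared coordinates of `v` are probability
weights. -/
lemma exp_quadForm_le {A : Matrix κ κ ℝ} (hA : A.IsHermitian) (v : κ → ℝ) (hv : v ⬝ᵥ v = 1) :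
    Real.exp (v ⬝ᵥ (A *ᵥ v)) ≤ v ⬝ᵥ (exp A *ᵥ v) := by
  obtain ⟨Q, d, hQ, hQ', hAe, hE⟩ := exists_spectral_quadForm hA
  rw [hE, dotProduct_conj_diagonal]
  conv_lhs => rw [hAe, dotProduct_conj_diagonal]
  have := convexOn_exp.map_sum_le (t := Finset.univ) (w := fun j => ((Qᵀ *ᵥ v) j) ^ 2) (p := d)
    (fun _ _ => sq_nonneg _) (by rw [sum_sq_transpose_mulVec hQ', hv]) (fun _ _ => Set.mem_univ _)
  simpa only [smul_eq_mul, mul_comm] using this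

lemma exp_quadForm_nonneg {A : Matrix κ κ ℝ} (hA : A.IsHermitian) (v : κ → ℝ) :
    0 ≤ v ⬝ᵥ (exp A *ᵥ v) := by
  obtain ⟨Q, d, hQ, hQ', hAe, hE⟩ := exists_spectral_quadForm hA
  rw [hE, dotProduct_conj_diagonal]
  positivity

lemma trace_exp_nonneg {A : Matrix κ κ ℝ} (hA : A.IsHermitian) : 0 ≤ (exp A).trace := by
  obtain ⟨Q, d, hQ, hQ', hAe, hE⟩ := exists_spectral_quadForm hA
  rw [hE, trace_conj_diagonal hQ]
  positivity

lemma transpose_row_unit {Q : Matrix κ κ ℝ} (hQ : Qᵀ * Q = 1) (j : κ) : Qᵀ j ⬝ᵥ Qᵀ j = 1 := by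
  have := congrFun (congrFun hQ j) j
  rw [one_apply_eq] at this
  exact this

/-- Peierls' inequality. -/
lemma sum_exp_diag_le_trace_exp {A Q : Matrix κ κ ℝ} (hA : A.IsHermitian) (hQ : Qᵀ * Q = 1) :
    ∑ j, Real.exp (Qᵀ j ⬝ᵥ (A *ᵥ Qᵀ j)) ≤ (exp A).trace := by
  have h : (exp A).trace = ∑ j, Qᵀ j ⬝ᵥ (exp A *ᵥ Qᵀ j) := by
    calc (exp A).trace = (exp A * (Q * Qᵀ)).trace := by
          rw [mul_eq_one_comm.1 hQ, Matrix.mul_one]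
      _ = (Qᵀ * exp A * Q).trace := by
          rw [← Matrix.mul_assoc, trace_mul_comm, ← Matrix.mul_assoc]
      _ = _ := Finset.sum_congr rfl fun j _ => transpose_mul_mul_diag Q (exp A) j
  rw [h]
  exact Finset.sum_le_sum fun j _ => exp_quadForm_le hA _ (transpose_row_unit hQ j)

lemma quadForm_eigenvector {Q : Matrix κ κ ℝ} (hQ : Qᵀ * Q = 1) (d : κ → ℝ) (j : κ) :
    Qᵀ j ⬝ᵥ ((Q * diagonal d * Qᵀ) *ᵥ Qᵀ j) = d j := by
  rw [← transpose_mul_mul_diag]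
  have : Qᵀ * (Q * diagonal d * Qᵀ) * Q = (Qᵀ * Q) * diagonal d * (Qᵀ * Q) := by
    simp only [Matrix.mul_assoc]
  rw [this, hQ, Matrix.one_mul, Matrix.mul_one, diagonal_apply_eq]

/-- The trace of the exponential is convex on symmetric matrices. -/
lemma convexOn_trace_exp :
    ConvexOn ℝ {A : Matrix κ κ ℝ | A.IsHermitian} fun A => (exp A).trace := by
  have hC : Convex ℝ {A : Matrix κ κ ℝ | A.IsHermitian} := by
    intro A hA B hB a b _ _ _
    exact (IsHermitian.smul hA (IsSelfAdjoint.all a)).add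
      (IsHermitian.smul hB (IsSelfAdjoint.all b))
  refine ⟨hC, fun A hA B hB a b ha hb hab => ?_⟩
  -- In an eigenbasis of the convex combination its trace is exact, while Peierls' inequality bounds
  -- the traces for `A` and `B` from below.
  obtain ⟨Q, d, hQ, hQ', hAe, hE⟩ := exists_spectral_quadForm (hC hA hB ha hb hab)
  have hd : ∀ j, d j = a * (Qᵀ j ⬝ᵥ (A *ᵥ Qᵀ j)) + b * (Qᵀ j ⬝ᵥ (B *ᵥ Qᵀ j)) := by
    intro j
    rw [← quadForm_eigenvector hQ d j, ← hAe]
    simp [add_mulVec, smul_mulVec, dotProduct_add, dotProduct_smul]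
  simp only
  rw [hE, trace_conj_diagonal hQ]
  calc ∑ j, Real.exp (d j) ≤ ∑ j, (a * Real.exp (Qᵀ j ⬝ᵥ (A *ᵥ Qᵀ j)) +
        b * Real.exp (Qᵀ j ⬝ᵥ (B *ᵥ Qᵀ j))) := by
        refine Finset.sum_le_sum fun j _ => ?_
        rw [hd]
        exact convexOn_exp.2 (Set.mem_univ _) (Set.mem_univ _) ha hb hab
    _ = a * ∑ j, Real.exp (Qᵀ j ⬝ᵥ (A *ᵥ Qᵀ j)) + b * ∑ j, Real.exp (Qᵀ j ⬝ᵥ (B *ᵥ Qᵀ j)) := by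
        rw [Finset.sum_add_distrib, Finset.mul_sum, Finset.mul_sum]
    _ ≤ a * (exp A).trace + b * (exp B).trace := by
        gcongr
        · exact sum_exp_diag_le_trace_exp hA hQ
        · exact sum_exp_diag_le_trace_exp hB hQ

/-- The tangent inequality for the trace of the exponential, in a direction of rank one. -/
lemma trace_exp_add_vecMulVec_ge {B : Matrix κ κ ℝ} (hB : B.IsHermitian) (u : κ → ℝ) (h : ℝ) :
    (exp B).trace + h * (u ⬝ᵥ (exp B *ᵥ u)) ≤ (exp (B + h • vecMulVec u u)).trace := by
  obtain ⟨Q, d, hQ, hQ', hBe, hE⟩ := exists_spectral_quadForm hB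
  have hH : (B + h • vecMulVec u u).IsHermitian :=
    hB.add (IsHermitian.smul (isHermitian_vecMulVec u) (IsSelfAdjoint.all h))
  -- Peierls' inequality in the eigenbasis of the unperturbed `B`, followed by `1 + x ≤ exp x` in
  -- each coordinate.
  refine le_trans ?_ (sum_exp_diag_le_trace_exp hH hQ)
  rw [hE, trace_conj_diagonal hQ, dotProduct_conj_diagonal, Finset.mul_sum,
    ← Finset.sum_add_distrib]
  refine Finset.sum_le_sum fun j _ => ?_
  have : Qᵀ j ⬝ᵥ ((B + h • vecMulVec u u) *ᵥ Qᵀ j) = d j + h * ((Qᵀ *ᵥ u) j) ^ 2 := by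
    rw [add_mulVec, dotProduct_add, smul_mulVec, dotProduct_smul, quadForm_vecMulVec]
    conv_lhs => rw [hBe, quadForm_eigenvector hQ d j]
    rfl
  rw [this, Real.exp_add]
  have h1 := Real.add_one_le_exp (h * ((Qᵀ *ᵥ u) j) ^ 2)
  have h2 := Real.exp_pos (d j)
  nlinarith

/-- Moments of a rank-one perturbation are dominated by those of the corresponding shift. -/
lemma quadForm_pow_add_vecMulVec_le {Q : Matrix κ κ ℝ} (hQ : Qᵀ * Q = 1) (hQ' : Q * Qᵀ = 1)
    (d : κ → ℝ) (hd : ∀ j, 0 ≤ d j) (u : κ → ℝ) {t : ℝ} (ht : 0 ≤ t) (k l : ℕ) :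
    u ⬝ᵥ ((Q * diagonal d * Qᵀ) ^ l *ᵥ ((Q * diagonal d * Qᵀ + t • vecMulVec u u) ^ k *ᵥ u)) ≤
      ∑ j, d j ^ l * (d j + t * (u ⬝ᵥ u)) ^ k * ((Qᵀ *ᵥ u) j) ^ 2 := by
  set B := Q * diagonal d * Qᵀ with hB
  have hw : 0 ≤ t * (u ⬝ᵥ u) := by
    rw [← sum_sq_transpose_mulVec hQ' u]
    positivity
  induction k generalizing l with
  | zero =>
    rw [pow_zero, one_mulVec, hB, conj_diagonal_pow hQ hQ', dotProduct_conj_diagonal]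
    simp
  | succ k ih =>
    set v := (B + t • vecMulVec u u) ^ k *ᵥ u with hv
    -- Splitting off one factor, the rank-one part yields a product of two moments; the other part
    -- raises `l`, which is why the induction is over all `l`.
    have hrec : u ⬝ᵥ (B ^ l *ᵥ ((B + t • vecMulVec u u) ^ (k + 1) *ᵥ u)) =
        u ⬝ᵥ (B ^ (l + 1) *ᵥ v) + t * ((u ⬝ᵥ v) * (u ⬝ᵥ (B ^ l *ᵥ u))) := by
      rw [pow_succ', ← mulVec_mulVec, ← hv, add_mulVec, mulVec_add, dotProduct_add, mulVec_mulVec,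
        ← pow_succ, smul_mulVec, vecMulVec_mulVec, mulVec_smul, dotProduct_smul]
      simp [mulVec_smul, dotProduct_smul]
    have hml : u ⬝ᵥ (B ^ l *ᵥ u) = ∑ j, d j ^ l * ((Qᵀ *ᵥ u) j) ^ 2 := by
      rw [hB, conj_diagonal_pow hQ hQ', dotProduct_conj_diagonal]
    have h0 := ih 0
    simp only [pow_zero, one_mulVec, one_mul] at h0
    have hml0 : 0 ≤ ∑ j, d j ^ l * ((Qᵀ *ᵥ u) j) ^ 2 :=
      Finset.sum_nonneg fun j _ => mul_nonneg (pow_nonneg (hd j) l) (sq_nonneg _)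
    -- Both sequences increase with `d j ≥ 0`, so the product of moments is at most `u ⬝ᵥ u` times
    -- one joint moment. This supplies the missing factor `d j + t * (u ⬝ᵥ u)`.
    have hcheb := weighted_chebyshev (fun j => ((Qᵀ *ᵥ u) j) ^ 2)
      (fun j => (d j + t * (u ⬝ᵥ u)) ^ k) (fun j => d j ^ l) (fun _ => sq_nonneg _) (by
        intro i j hij
        have : d i ≤ d j := by
          by_contra hlt
          exact absurd hij (not_lt.2 (pow_le_pow_left₀ (hd j) (not_le.1 hlt).le l))
        exact pow_le_pow_left₀ (add_nonneg (hd i) hw) (by linarith) k)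
    rw [sum_sq_transpose_mulVec hQ'] at hcheb
    rw [hrec, hml]
    calc _ ≤ ∑ j, d j ^ (l + 1) * (d j + t * (u ⬝ᵥ u)) ^ k * ((Qᵀ *ᵥ u) j) ^ 2 +
          t * ((∑ j, (d j + t * (u ⬝ᵥ u)) ^ k * ((Qᵀ *ᵥ u) j) ^ 2) *
            ∑ j, d j ^ l * ((Qᵀ *ᵥ u) j) ^ 2) := by
          gcongr
          exact ih (l + 1)
      _ ≤ ∑ j, d j ^ (l + 1) * (d j + t * (u ⬝ᵥ u)) ^ k * ((Qᵀ *ᵥ u) j) ^ 2 +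
          t * ((u ⬝ᵥ u) * ∑ j, (d j + t * (u ⬝ᵥ u)) ^ k * d j ^ l * ((Qᵀ *ᵥ u) j) ^ 2) := by
          gcongr
      _ = _ := by
          rw [Finset.mul_sum, Finset.mul_sum, ← Finset.sum_add_distrib]
          refine Finset.sum_congr rfl fun j _ => ?_
          ring

/-- The exponential of a rank-one perturbation, tested on the direction of the perturbation. -/
lemma quadForm_exp_add_vecMulVec_le {B : Matrix κ κ ℝ} (hB : B.IsHermitian) (u : κ → ℝ) {t : ℝ}
    (ht : 0 ≤ t) :
    u ⬝ᵥ (exp (B + t • vecMulVec u u) *ᵥ u) ≤ Real.exp (t * (u ⬝ᵥ u)) * (u ⬝ᵥ (exp B *ᵥ u)) := by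
  obtain ⟨Q, d, hQ, hQ', hBe, hE⟩ := exists_spectral_quadForm hB
  have hH : (B + t • vecMulVec u u).IsHermitian :=
    hB.add (IsHermitian.smul (isHermitian_vecMulVec u) (IsSelfAdjoint.all t))
  obtain ⟨Q₂, d₂, hQ₂, hQ₂', hBe₂, hE₂⟩ := exists_spectral_quadForm hH
  -- Adding `c` to the spectrum makes `B` positive semidefinite, so the moments, hence the
  -- exponential series, compare term by term; the factor `exp c` cancels at the end.
  set c : ℝ := ∑ j, |d j| with hc
  have hdc : ∀ j, 0 ≤ d j + c := by
    intro j
    have := Finset.single_le_sum (f := fun j => |d j|) (fun i _ => abs_nonneg _)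
      (Finset.mem_univ j)
    linarith [neg_abs_le (d j)]
  have hshift : ∀ (R : Matrix κ κ ℝ) (e : κ → ℝ), R * Rᵀ = 1 →
      R * diagonal (fun j => e j + c) * Rᵀ = R * diagonal e * Rᵀ + c • (1 : Matrix κ κ ℝ) := by
    intro R e hR
    have : diagonal (fun j => e j + c) = diagonal e + c • (1 : Matrix κ κ ℝ) := by
      ext i j
      by_cases h : i = j <;> simp [h]
    rw [this, Matrix.mul_add, Matrix.add_mul, Matrix.mul_smul, Matrix.smul_mul, Matrix.mul_one, hR]
  have hmom : ∀ k : ℕ, ∑ j, (d₂ j + c) ^ k * ((Q₂ᵀ *ᵥ u) j) ^ 2 ≤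
      ∑ j, (d j + c + t * (u ⬝ᵥ u)) ^ k * ((Qᵀ *ᵥ u) j) ^ 2 := by
    intro k
    have h := quadForm_pow_add_vecMulVec_le hQ hQ' (fun j => d j + c) hdc u ht k 0
    rw [hshift Q d hQ', ← hBe, pow_zero, one_mulVec] at h
    have e : B + c • (1 : Matrix κ κ ℝ) + t • vecMulVec u u =
        Q₂ * diagonal (fun j => d₂ j + c) * Q₂ᵀ := by
      rw [hshift Q₂ d₂ hQ₂', ← hBe₂]
      abel
    rw [e, conj_diagonal_pow hQ₂ hQ₂', dotProduct_conj_diagonal] at h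
    simpa using h
  have hle := hasSum_le (fun k => div_le_div_of_nonneg_right (hmom k) (Nat.cast_nonneg k.factorial))
    (hasSum_weighted_exp (fun j => d₂ j + c) fun j => ((Q₂ᵀ *ᵥ u) j) ^ 2)
    (hasSum_weighted_exp (fun j => d j + c + t * (u ⬝ᵥ u)) fun j => ((Qᵀ *ᵥ u) j) ^ 2)
  rw [hE₂, hE, dotProduct_conj_diagonal, dotProduct_conj_diagonal]
  refine le_of_mul_le_mul_left ?_ (Real.exp_pos c)
  calc _ = ∑ j, Real.exp (d₂ j + c) * ((Q₂ᵀ *ᵥ u) j) ^ 2 := by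
        rw [Finset.mul_sum]
        refine Finset.sum_congr rfl fun j _ => ?_
        rw [Real.exp_add]; ring
    _ ≤ _ := hle
    _ = _ := by
        simp only [Finset.mul_sum]
        refine Finset.sum_congr rfl fun j _ => ?_
        rw [Real.exp_add, Real.exp_add]; ring

/-- A decrement of the trace of the exponential under a rank-one decrement of the exponent. -/
lemma trace_exp_sub_vecMulVec_le_of_step {A : Matrix κ κ ℝ} (hA : A.IsHermitian) (u : κ → ℝ)
    {h t R : ℝ} (hh : 0 ≤ h) (ht : 0 ≤ t) (hR : u ⬝ᵥ u ≤ R) :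
    (exp (A - (t + h) • vecMulVec u u)).trace + h * (1 - (t + h) * R) * (u ⬝ᵥ (exp A *ᵥ u)) ≤
      (exp (A - t • vecMulVec u u)).trace := by
  have hB : (A - (t + h) • vecMulVec u u).IsHermitian :=
    hA.sub (IsHermitian.smul (isHermitian_vecMulVec u) (IsSelfAdjoint.all _))
  -- The tangent is taken at the far end of the step; its slope there is compared with the one at
  -- `A` by the preceding lemma.
  have h1 := trace_exp_add_vecMulVec_ge hB u h
  have h2 := quadForm_exp_add_vecMulVec_le hB u (add_nonneg ht hh)
  rw [sub_add_cancel] at h2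
  have e : A - (t + h) • vecMulVec u u + h • vecMulVec u u = A - t • vecMulVec u u := by
    rw [add_smul]; abel
  rw [e] at h1
  refine le_trans ?_ h1
  have h0 := exp_quadForm_nonneg hA u
  have h3 : (1 - (t + h) * R) * (u ⬝ᵥ (exp A *ᵥ u)) ≤
      u ⬝ᵥ (exp (A - (t + h) • vecMulVec u u) *ᵥ u) := by
    calc _ ≤ Real.exp (-((t + h) * (u ⬝ᵥ u))) * (u ⬝ᵥ (exp A *ᵥ u)) := by
          gcongr
          have := Real.add_one_le_exp (-((t + h) * (u ⬝ᵥ u)))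
          have := mul_le_mul_of_nonneg_left hR (add_nonneg ht hh)
          linarith
      _ ≤ Real.exp (-((t + h) * (u ⬝ᵥ u))) * (Real.exp ((t + h) * (u ⬝ᵥ u)) *
            (u ⬝ᵥ (exp (A - (t + h) • vecMulVec u u) *ᵥ u))) := by gcongr
      _ = _ := by rw [← mul_assoc, ← Real.exp_add]; simp
  have := mul_le_mul_of_nonneg_left h3 hh
  linarith

/-- Cutting `θ` into `k` equal steps gives the coefficient `(k + 1) / (2 * k)` of `θ * R`. Three
steps give `2 / 3`, exactly what the constant `3 / 8` in the Chernoff bound requires. -/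
lemma trace_exp_sub_vecMulVec_le {A : Matrix κ κ ℝ} (hA : A.IsHermitian) (u : κ → ℝ)
    {θ R : ℝ} (hθ : 0 ≤ θ) (hR : u ⬝ᵥ u ≤ R) :
    (exp (A - θ • vecMulVec u u)).trace ≤
      (exp A).trace - θ * (1 - 2 / 3 * θ * R) * (u ⬝ᵥ (exp A *ᵥ u)) := by
  have hh : 0 ≤ θ / 3 := by positivity
  have h1 := trace_exp_sub_vecMulVec_le_of_step hA u hh le_rfl hR
  have h2 := trace_exp_sub_vecMulVec_le_of_step hA u hh hh hR
  have h3 := trace_exp_sub_vecMulVec_le_of_step hA u hh (add_nonneg hh hh) hR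
  rw [zero_smul, sub_zero, zero_add] at h1
  have e : θ / 3 + θ / 3 + θ / 3 = θ := by ring
  rw [e] at h3
  linear_combination h1 + h2 + h3

variable {m : Type*} [Fintype m]

lemma sum_quadForm_eq_trace (u : m → κ → ℝ) (hu : ∑ a, vecMulVec (u a) (u a) = 1)
    (M : Matrix κ κ ℝ) : ∑ a, u a ⬝ᵥ (M *ᵥ u a) = M.trace := by
  have : ∀ a, u a ⬝ᵥ (M *ᵥ u a) = (M * vecMulVec (u a) (u a)).trace := by
    intro a
    rw [mul_vecMulVec, trace_vecMulVec, dotProduct_comm]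
  rw [Finset.sum_congr rfl fun a _ => this a, ← trace_sum, ← Matrix.mul_sum, hu, Matrix.mul_one]

/-- The matrix Laplace transform. Samples are peeled off one at a time from an arbitrary symmetric
`A`; as the `vecMulVec (u a) (u a)` sum to the identity, the mean decrement is a multiple of `tr exp
A` itself. -/
lemma sum_trace_exp_le [Nonempty m] (u : m → κ → ℝ) (hu : ∑ a, vecMulVec (u a) (u a) = 1)
    {θ R : ℝ} (hθ : 0 ≤ θ) (hR : ∀ a, u a ⬝ᵥ u a ≤ R) {n : ℕ} {A : Matrix κ κ ℝ}
    (hA : A.IsHermitian) :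
    ∑ t : Fin n → m, (exp (A - θ • ∑ i, vecMulVec (u (t i)) (u (t i)))).trace ≤
      (Fintype.card m : ℝ) ^ n *
        (Real.exp (-(n * (θ * (1 - 2 / 3 * θ * R) / Fintype.card m))) * (exp A).trace) := by
  set N : ℝ := (Fintype.card m : ℝ) with hN
  have hN0 : 0 < N := by rw [hN]; exact_mod_cast Fintype.card_pos
  set q : ℝ := θ * (1 - 2 / 3 * θ * R) with hq
  induction n generalizing A with
  | zero => simp
  | succ n ih =>
    rw [sum_seq_succ]
    have hB : ∀ a, (A - θ • vecMulVec (u a) (u a)).IsHermitian := fun a =>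
      hA.sub (IsHermitian.smul (isHermitian_vecMulVec _) (IsSelfAdjoint.all _))
    have e : ∀ a (t : Fin n → m), A - θ • ∑ i : Fin (n + 1),
        vecMulVec (u ((Fin.cons a t : Fin (n + 1) → m) i))
          (u ((Fin.cons a t : Fin (n + 1) → m) i)) =
        A - θ • vecMulVec (u a) (u a) - θ • ∑ i, vecMulVec (u (t i)) (u (t i)) := by
      intro a t
      rw [Fin.sum_univ_succ, smul_add]
      simp only [Fin.cons_zero, Fin.cons_succ]
      abel
    simp only [e]
    calc _ ≤ ∑ a, N ^ n * (Real.exp (-(n * (q / N))) *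
          (exp (A - θ • vecMulVec (u a) (u a))).trace) := Finset.sum_le_sum fun a _ => ih (hB a)
      _ = N ^ n * Real.exp (-(n * (q / N))) *
          ∑ a, (exp (A - θ • vecMulVec (u a) (u a))).trace := by
          rw [Finset.mul_sum]
          exact Finset.sum_congr rfl fun a _ => by ring
      _ ≤ N ^ n * Real.exp (-(n * (q / N))) *
          ∑ a, ((exp A).trace - q * (u a ⬝ᵥ (exp A *ᵥ u a))) := by
          gcongr with a
          exact trace_exp_sub_vecMulVec_le hA (u a) hθ (hR a)
      _ = N ^ n * Real.exp (-(n * (q / N))) * (N * ((1 - q / N) * (exp A).trace)) := by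
          rw [Finset.sum_sub_distrib, ← Finset.mul_sum, sum_quadForm_eq_trace u hu,
            Finset.sum_const, Finset.card_univ, nsmul_eq_mul, ← hN]
          field_simp
      _ ≤ N ^ n * Real.exp (-(n * (q / N))) * (N * (Real.exp (-(q / N)) * (exp A).trace)) := by
          have := trace_exp_nonneg hA
          gcongr
          linarith [Real.add_one_le_exp (-(q / N))]
      _ = N ^ (n + 1) * ((Real.exp (-(n * (q / N))) * Real.exp (-(q / N))) * (exp A).trace) := by
          ring
      _ = _ := by
          rw [← Real.exp_add]
          push_cast
          ring_nf

/-- The lower tail of the matrix Chernoff bound for sums of sampled rank-one matrices, for sampling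
with or without replacement. -/
lemma IsSampleSpace.card_filter_quadForm_lt_le [DecidableEq m] [Nonempty m] {n : ℕ}
    {S : Finset (Fin n → m)} (hS : IsSampleSpace S) (u : m → κ → ℝ)
    (hu : ∑ a, vecMulVec (u a) (u a) = 1) {R δ : ℝ} (hR0 : 0 < R) (hR : ∀ a, u a ⬝ᵥ u a ≤ R)
    (hδ : 0 ≤ δ) (bad : (Fin n → m) → Prop) [DecidablePred bad]
    (hbad : ∀ t, bad t → ∃ v : κ → ℝ, v ⬝ᵥ v = 1 ∧
      ∑ i, (v ⬝ᵥ u (t i)) ^ 2 ≤ (1 - δ) * (n / Fintype.card m)) :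
    ((S.filter bad).card : ℝ) ≤
      Fintype.card κ * Real.exp (-(3 / 8 * δ ^ 2 * (n / (Fintype.card m * R)))) * S.card := by
  set N : ℝ := (Fintype.card m : ℝ) with hN
  have hN0 : 0 < N := by rw [hN]; exact_mod_cast Fintype.card_pos
  -- The maximizer of `θ * δ - 2 / 3 * θ ^ 2 * R`, with maximum `3 * δ ^ 2 / (8 * R)`.
  set θ : ℝ := 3 * δ / (4 * R) with hθ
  have hθ0 : 0 ≤ θ := by positivity
  have hsumH : ∀ t : Fin n → m, (∑ i, vecMulVec (u (t i)) (u (t i))).IsHermitian := by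
    intro t
    have : IsSelfAdjoint (∑ i, vecMulVec (u (t i)) (u (t i))) :=
      isSelfAdjoint_sum _ fun i _ => isHermitian_vecMulVec _
    exact this
  have hH : ∀ M : Matrix κ κ ℝ, M.IsHermitian → ((-θ) • M).IsHermitian := fun M hM =>
    IsHermitian.smul hM (IsSelfAdjoint.all _)
  refine hS.card_filter_le (fun a => vecMulVec (u a) (u a)) (C := {A | A.IsHermitian})
    (φ := fun M => (exp ((-θ) • M)).trace) ?_ hsumH
    (fun t => trace_exp_nonneg (hH _ (hsumH t)))
    (B := Real.exp (-(n * (θ * (1 - 2 / 3 * θ * R) / N))) * Fintype.card κ)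
    (a := Real.exp (-(θ * ((1 - δ) * (n / N))))) (Real.exp_pos _) ?_ ?_ bad ?_
  · refine ⟨convexOn_trace_exp.1, fun A hA B hB a b ha hb hab => ?_⟩
    have := convexOn_trace_exp.2 (hH A hA) (hH B hB) ha hb hab
    simp only at this ⊢
    rwa [smul_comm a, smul_comm b, ← smul_add] at this
  · have := sum_trace_exp_le u hu hθ0 hR (n := n) (A := 0) isHermitian_zero
    simpa [sub_eq_add_neg] using this
  · have : Real.exp (-(n * (θ * (1 - 2 / 3 * θ * R) / N))) =
        Real.exp (-(3 / 8 * δ ^ 2 * (n / (N * R)))) * Real.exp (-(θ * ((1 - δ) * (n / N)))) := by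
      rw [← Real.exp_add, hθ]
      congr 1
      field_simp
      ring
    rw [this]
    exact le_of_eq (by ring)
  · intro t ht
    obtain ⟨v, hv, hle⟩ := hbad t ht
    have hq : v ⬝ᵥ (((-θ) • ∑ i, vecMulVec (u (t i)) (u (t i))) *ᵥ v) =
        -(θ * ∑ i, (v ⬝ᵥ u (t i)) ^ 2) := by
      rw [smul_mulVec, dotProduct_smul, sum_mulVec, dotProduct_sum]
      simp only [quadForm_vecMulVec]
      simp
    have h1 := exp_quadForm_le (hH _ (hsumH t)) v hv
    rw [hq] at h1
    obtain ⟨Q, d, hQ, hQ', hBe, hE⟩ := exists_spectral_quadForm (hH _ (hsumH t))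
    have h2 : v ⬝ᵥ (exp ((-θ) • ∑ i, vecMulVec (u (t i)) (u (t i))) *ᵥ v) ≤
        (exp ((-θ) • ∑ i, vecMulVec (u (t i)) (u (t i)))).trace := by
      rw [hE, trace_conj_diagonal hQ, dotProduct_conj_diagonal]
      refine Finset.sum_le_sum fun j _ => mul_le_of_le_one_right (Real.exp_pos _).le ?_
      rw [← hv, ← sum_sq_transpose_mulVec hQ' v]
      exact Finset.single_le_sum (f := fun j => ((Qᵀ *ᵥ v) j) ^ 2) (fun _ _ => sq_nonneg _)
        (Finset.mem_univ j)
    refine le_trans (Real.exp_le_exp.2 ?_) (h1.trans h2)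
    have := mul_le_mul_of_nonneg_left hle hθ0
    linarith

end TraceExp

/-! ### Tails of the sampled energy and of the cross term. -/

section SampledSums

open Matrix

variable {m : Type*} [Fintype m] [Nonempty m]

lemma sum_seq_sum (g : m → ℝ) (n : ℕ) :
    ∑ t : Fin n → m, ∑ i, g (t i) =
      (Fintype.card m : ℝ) ^ n * (n / Fintype.card m * ∑ a, g a) := by
  have hN0 : (Fintype.card m : ℝ) ≠ 0 := by exact_mod_cast Fintype.card_ne_zero
  induction n with
  | zero => simp
  | succ n ih =>
    rw [sum_seq_succ]
    simp only [Fin.sum_univ_succ, Fin.cons_zero, Fin.cons_succ, Finset.sum_add_distrib, ih,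
      Finset.sum_const, Finset.card_univ, Fintype.card_fun, Fintype.card_fin, nsmul_eq_mul,
      ← Finset.mul_sum]
    push_cast
    field_simp
    ring

/-- Cross terms vanish because the `Z a` have mean zero; the offset `v` carries the samples already
drawn through the induction. -/
lemma sum_seq_norm_sq {E : Type*} [NormedAddCommGroup E] [InnerProductSpace ℝ E] (Z : m → E)
    (hZ : ∑ a, Z a = 0) (n : ℕ) (v : E) :
    ∑ t : Fin n → m, ‖v + ∑ i, Z (t i)‖ ^ 2 =
      (Fintype.card m : ℝ) ^ n * (‖v‖ ^ 2 + n / Fintype.card m * ∑ a, ‖Z a‖ ^ 2) := by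
  have hN0 : (Fintype.card m : ℝ) ≠ 0 := by exact_mod_cast Fintype.card_ne_zero
  induction n generalizing v with
  | zero => simp
  | succ n ih =>
    rw [sum_seq_succ]
    simp only [Fin.sum_univ_succ, Fin.cons_zero, Fin.cons_succ, ← add_assoc, ih]
    have h : ∑ a, ‖v + Z a‖ ^ 2 = Fintype.card m * ‖v‖ ^ 2 + ∑ a, ‖Z a‖ ^ 2 := by
      simp only [norm_add_sq_real, Finset.sum_add_distrib, ← Finset.mul_sum, ← inner_sum, hZ,
        inner_zero_right]
      simp
    rw [← Finset.mul_sum, Finset.sum_add_distrib, h]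
    simp only [Finset.sum_const, Finset.card_univ, nsmul_eq_mul]
    push_cast
    field_simp
    ring

variable [DecidableEq m] {n : ℕ} {S : Finset (Fin n → m)}

/-- The upper tail of the energy of the sampled signal. -/
lemma IsSampleSpace.card_filter_energy_gt_le (hS : IsSampleSpace S) (hn : 0 < n) (g : m → ℝ)
    {G ν : ℝ} (hG : 0 < G) (hgG : ∑ a, g a = G) (hν : 0 < ν) (hg : ∀ a, 0 ≤ g a)
    (hgν : ∀ a, g a ≤ ν / Fintype.card m * G) {β : ℝ} (hβ : 0 ≤ β) (bad : (Fin n → m) → Prop)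
    [DecidablePred bad]
    (hbad : ∀ t, bad t → (1 + β) * (n / Fintype.card m) * G ≤ ∑ i, g (t i)) :
    ((S.filter bad).card : ℝ) ≤ Real.exp (-(2 * β ^ 2 * n / ν ^ 2)) * S.card := by
  have hN0 : 0 < (Fintype.card m : ℝ) := by exact_mod_cast Fintype.card_pos
  have hn0 : 0 < (n : ℝ) := by exact_mod_cast hn
  have h := hS.card_filter_convex_ge_le hn g (h := fun v => v) (convexOn_id convex_univ)
    (c := ν / Fintype.card m * G) (by positivity) (fun v a b => by linarith [hg b, hgν a])
    (M := n / Fintype.card m * G) (by rw [sum_seq_sum, hgG])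
    (r := β * (n / Fintype.card m * G)) (by positivity) bad
    (fun t ht => by linarith [hbad t ht])
  convert h using 4
  field_simp

/-- The lower tail of the energy of the sampled signal. -/
lemma IsSampleSpace.card_filter_energy_lt_le (hS : IsSampleSpace S) (hn : 0 < n) (g : m → ℝ)
    {G ν : ℝ} (hG : 0 < G) (hgG : ∑ a, g a = G) (hν : 0 < ν) (hg : ∀ a, 0 ≤ g a)
    (hgν : ∀ a, g a ≤ ν / Fintype.card m * G) {β : ℝ} (hβ : 0 ≤ β) (bad : (Fin n → m) → Prop)
    [DecidablePred bad]
    (hbad : ∀ t, bad t → ∑ i, g (t i) ≤ (1 - β) * (n / Fintype.card m) * G) :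
    ((S.filter bad).card : ℝ) ≤ Real.exp (-(2 * β ^ 2 * n / ν ^ 2)) * S.card := by
  have hN0 : 0 < (Fintype.card m : ℝ) := by exact_mod_cast Fintype.card_pos
  have hn0 : 0 < (n : ℝ) := by exact_mod_cast hn
  have h := hS.card_filter_convex_ge_le hn (fun a => - g a) (h := fun v => v)
    (convexOn_id convex_univ)
    (c := ν / Fintype.card m * G) (by positivity) (fun v a b => by linarith [hg a, hgν b])
    (M := -(n / Fintype.card m * G))
    (by rw [sum_seq_sum (fun a => -g a), Finset.sum_neg_distrib, hgG]; exact le_of_eq (by ring))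
    (r := β * (n / Fintype.card m * G)) (by positivity) bad
    (fun t ht => by rw [Finset.sum_neg_distrib]; linarith [hbad t ht])
  convert h using 4
  field_simp

/-- The upper tail of the norm of a sampled sum of vectors `y a • w a` with mean zero. -/
lemma IsSampleSpace.card_filter_norm_gt_le {E : Type*} [NormedAddCommGroup E]
    [InnerProductSpace ℝ E] (hS : IsSampleSpace S) (hn : 0 < n) (y : m → ℝ) (w : m → E)
    (hyw : ∑ a, y a • w a = 0) {G ν R : ℝ} (hG : 0 < G) (hyG : ∑ a, y a ^ 2 = G) (hν : 0 < ν)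
    (hyν : ∀ a, y a ^ 2 ≤ ν / Fintype.card m * G) (hR : 0 < R) (hw : ∀ a, ‖w a‖ ^ 2 ≤ R)
    {γ : ℝ} (hγ : 0 ≤ γ) (bad : (Fin n → m) → Prop) [DecidablePred bad]
    (hbad : ∀ t, bad t →
      (1 + γ) ^ 2 * (n / Fintype.card m * R * G) ≤ ‖∑ i, y (t i) • w (t i)‖ ^ 2) :
    ((S.filter bad).card : ℝ) ≤ Real.exp (-(γ ^ 2 / (2 * ν))) * S.card := by
  set N : ℝ := (Fintype.card m : ℝ) with hN
  have hN0 : 0 < N := by rw [hN]; exact_mod_cast Fintype.card_pos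
  have hn0 : 0 < (n : ℝ) := by exact_mod_cast hn
  have hZ : ∀ a, ‖y a • w a‖ ≤ √(ν / N * G * R) := by
    intro a
    refine Real.le_sqrt_of_sq_le ?_
    rw [norm_smul, mul_pow, Real.norm_eq_abs, sq_abs]
    exact mul_le_mul (hyν a) (hw a) (sq_nonneg _) (by positivity)
  have hsum : ∑ a, ‖y a • w a‖ ^ 2 ≤ R * G := by
    rw [← hyG, Finset.mul_sum]
    refine Finset.sum_le_sum fun a _ => ?_
    rw [norm_smul, mul_pow, Real.norm_eq_abs, sq_abs, mul_comm]
    exact mul_le_mul_of_nonneg_right (hw a) (sq_nonneg _)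
  -- Cauchy-Schwarz: the mean norm is at most the root of the mean square.
  have hM : ∑ t : Fin n → m, ‖∑ i, y (t i) • w (t i)‖ ≤ N ^ n * √(n / N * R * G) := by
    refine le_of_sq_le_sq ?_ (by positivity)
    refine sq_sum_le_card_mul_sum_sq.trans ?_
    have h := sum_seq_norm_sq (fun a => y a • w a) hyw n 0
    simp only [zero_add, norm_zero, ne_eq, OfNat.ofNat_ne_zero, not_false_eq_true, zero_pow] at h
    rw [h, mul_pow, Real.sq_sqrt (by positivity)]
    simp only [Finset.card_univ, Fintype.card_fun, Fintype.card_fin, Nat.cast_pow, ← hN]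
    calc _ ≤ N ^ n * (N ^ n * (n / N * (R * G))) := by gcongr
      _ = _ := by ring
  -- Exchanging one sample removes one vector and adds another, hence the factor `2` in `c`.
  have h := hS.card_filter_convex_ge_le hn (fun a => y a • w a) (h := fun v => ‖v‖)
    (convexOn_univ_norm) (c := 2 * √(ν / N * G * R)) (by positivity)
    (fun v a b => by
      have h1 := norm_sub_norm_le (v + y a • w a) (v + y b • w b)
      have h2 := norm_sub_le (y a • w a) (y b • w b)
      rw [add_sub_add_left_eq_sub] at h1
      linarith [hZ a, hZ b])
    hM (r := γ * √(n / N * R * G)) (by positivity) bad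
    (fun t ht => by
      refine le_of_sq_le_sq ?_ (norm_nonneg _)
      refine le_trans (le_of_eq ?_) (hbad t ht)
      rw [← one_add_mul, mul_pow, Real.sq_sqrt (by positivity)])
  convert h using 4
  rw [mul_pow, mul_pow, Real.sq_sqrt (by positivity), Real.sq_sqrt (by positivity)]
  field_simp

end SampledSums

/-! ### Coherence as a bound on rows and entries. -/

section Coherence

open Matrix

variable {m κ : Type*} [Fintype m] {W : Matrix m κ ℝ}

lemma inner_toLp_column (W : Matrix m κ ℝ) (x : EuclideanSpace ℝ m) (k : κ) :
    inner ℝ (WithLp.toLp 2 fun i => W i k : EuclideanSpace ℝ m) x = (Wᵀ *ᵥ x.ofLp) k := by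
  rw [PiLp.inner_apply, mulVec, dotProduct]
  refine Finset.sum_congr rfl fun i _ => ?_
  simp [mul_comm]

variable [DecidableEq κ]

lemma sum_vecMulVec_rows (hW : Wᵀ * W = 1) : ∑ a, vecMulVec (W a) (W a) = 1 := by
  rw [← hW]
  ext k l
  simp [Matrix.sum_apply, vecMulVec_apply, mul_apply]

lemma orthonormal_columns (hW : Wᵀ * W = 1) :
    Orthonormal ℝ (fun k => (WithLp.toLp 2 fun i => W i k : EuclideanSpace ℝ m)) := by
  rw [orthonormal_iff_ite]
  intro k l
  rw [inner_toLp_column]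
  have := congrFun (congrFun hW k) l
  rw [one_apply] at this
  exact this

variable [Fintype κ]

lemma finrank_colSpan (hW : Wᵀ * W = 1) : Module.finrank ℝ (colSpan W) = Fintype.card κ :=
  finrank_span_eq_card (orthonormal_columns hW).linearIndependent

variable [DecidableEq m]

lemma norm_sq_starProjection_le_coherence (T : Submodule ℝ (EuclideanSpace ℝ m)) (a : m)
    (hT : 0 < Module.finrank ℝ T) :
    ‖T.starProjection (EuclideanSpace.single a (1 : ℝ))‖ ^ 2 ≤
      Module.finrank ℝ T * coherence T / Fintype.card m := by
  have : Nonempty m := ⟨a⟩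
  have hN0 : (Fintype.card m : ℝ) ≠ 0 := by exact_mod_cast Fintype.card_ne_zero
  have hr : (Module.finrank ℝ T : ℝ) ≠ 0 := by exact_mod_cast hT.ne'
  have e : Module.finrank ℝ T * coherence T / Fintype.card m =
      ⨆ j : m, ‖T.starProjection (EuclideanSpace.single j (1 : ℝ))‖ ^ 2 := by
    rw [coherence]
    field_simp
  rw [e]
  exact le_ciSup (f := fun j : m => ‖T.starProjection (EuclideanSpace.single j (1 : ℝ))‖ ^ 2)
    (Set.finite_range _).bddAbove a

/-- The row `W a` lists the coordinates of the projected basis vector in the orthonormal columns, so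
Bessel's inequality suffices. -/
lemma row_dotProduct_le_coherence [Nonempty κ] (hW : Wᵀ * W = 1) (a : m) :
    W a ⬝ᵥ W a ≤ Fintype.card κ * coherence (colSpan W) / Fintype.card m := by
  have h := norm_sq_starProjection_le_coherence (colSpan W) a
    (by rw [finrank_colSpan hW]; exact Fintype.card_pos)
  rw [finrank_colSpan hW] at h
  refine le_trans ?_ h
  have hB := (orthonormal_columns hW).sum_inner_products_le (s := Finset.univ)
    (x := (colSpan W).starProjection (EuclideanSpace.single a (1 : ℝ)))
  refine le_trans (le_of_eq ?_) hB
  refine Finset.sum_congr rfl fun k _ => ?_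
  have hk : (WithLp.toLp 2 fun i => W i k : EuclideanSpace ℝ m) ∈ colSpan W :=
    Submodule.subset_span (Set.mem_range_self k)
  rw [← Submodule.inner_starProjection_left_eq_right, Submodule.starProjection_eq_self_iff.2 hk]
  simp [EuclideanSpace.inner_single_right, sq]

/-- The entry `y a` is the inner product of `y` with the projection of the basis vector onto its
line; Cauchy-Schwarz concludes. -/
lemma sq_le_vecCoherence {y : EuclideanSpace ℝ m} (hy : y ≠ 0) (a : m) :
    y a ^ 2 ≤ vecCoherence y / Fintype.card m * ‖y‖ ^ 2 := by
  have hf : Module.finrank ℝ (Submodule.span ℝ {y}) = 1 := finrank_span_singleton hy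
  have h := norm_sq_starProjection_le_coherence (Submodule.span ℝ {y}) a (by rw [hf]; exact one_pos)
  rw [hf, Nat.cast_one, one_mul] at h
  have h1 : y a = inner ℝ y ((Submodule.span ℝ {y}).starProjection
      (EuclideanSpace.single a (1 : ℝ))) := by
    rw [← Submodule.inner_starProjection_left_eq_right,
      Submodule.starProjection_eq_self_iff.2 (Submodule.mem_span_singleton_self y)]
    simp [EuclideanSpace.inner_single_right]
  have h2 := abs_real_inner_le_norm y ((Submodule.span ℝ {y}).starProjection
      (EuclideanSpace.single a (1 : ℝ)))
  rw [← h1] at h2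
  calc y a ^ 2 = |y a| ^ 2 := (sq_abs _).symm
    _ ≤ (‖y‖ * ‖(Submodule.span ℝ {y}).starProjection (EuclideanSpace.single a (1 : ℝ))‖) ^ 2 := by
        gcongr
    _ = ‖(Submodule.span ℝ {y}).starProjection (EuclideanSpace.single a (1 : ℝ))‖ ^ 2 *
        ‖y‖ ^ 2 := by ring
    _ ≤ _ := by gcongr; exact h

lemma vecCoherence_pos {y : EuclideanSpace ℝ m} (hy : y ≠ 0) : 0 < vecCoherence y := by
  by_contra hneg
  apply hy
  ext a
  have h := sq_le_vecCoherence hy a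
  have : vecCoherence y / Fintype.card m * ‖y‖ ^ 2 ≤ 0 :=
    mul_nonpos_of_nonpos_of_nonneg
      (div_nonpos_of_nonpos_of_nonneg (not_lt.1 hneg) (Nat.cast_nonneg _)) (sq_nonneg _)
  exact pow_eq_zero_iff (two_ne_zero) |>.1 (le_antisymm (h.trans this) (sq_nonneg _))

lemma coherence_colSpan_pos [Nonempty κ] (hW : Wᵀ * W = 1) : 0 < coherence (colSpan W) := by
  obtain ⟨k⟩ := ‹Nonempty κ›
  by_contra hneg
  have h0 : ∀ a, W a k = 0 := by
    intro a
    have h := row_dotProduct_le_coherence hW a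
    have h1 : Fintype.card κ * coherence (colSpan W) / Fintype.card m ≤ 0 :=
      div_nonpos_of_nonpos_of_nonneg
        (mul_nonpos_of_nonneg_of_nonpos (Nat.cast_nonneg _) (not_lt.1 hneg)) (Nat.cast_nonneg _)
    have h2 : W a ⬝ᵥ W a = 0 :=
      le_antisymm (h.trans h1) (Finset.sum_nonneg fun _ _ => mul_self_nonneg _)
    exact congrFun (dotProduct_self_eq_zero.1 h2) k
  have := congrFun (congrFun hW k) k
  simp [mul_apply, h0] at this

end Coherence

/-! ### Residuals after projection onto a column space. -/

section Residual

open Matrix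

variable {m κ : Type*} [Fintype κ]

lemma mem_colSpan_iff {W : Matrix m κ ℝ} {x : EuclideanSpace ℝ m} :
    x ∈ colSpan W ↔ ∃ c : κ → ℝ, x = WithLp.toLp 2 (W *ᵥ c) := by
  rw [colSpan, Submodule.mem_span_range_iff_exists_fun]
  refine exists_congr fun c => ?_
  rw [eq_comm]
  have : ∑ k, c k • (WithLp.toLp 2 fun i => W i k : EuclideanSpace ℝ m) =
      WithLp.toLp 2 (W *ᵥ c) := by
    ext i
    simp [mulVec, dotProduct, mul_comm]
  rw [this]

variable [Fintype m]

lemma residual_add_of_mem (T : Submodule ℝ (EuclideanSpace ℝ m)) {x y : EuclideanSpace ℝ m}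
    (hx : x ∈ T) : residual T (x + y) = residual T y := by
  rw [residual, residual, map_add, Submodule.starProjection_eq_self_iff.2 hx,
    add_sub_add_left_eq_sub]

lemma residual_le_norm_sq (T : Submodule ℝ (EuclideanSpace ℝ m)) (y : EuclideanSpace ℝ m) :
    residual T y ≤ ‖y‖ ^ 2 := by
  have h := T.norm_sq_eq_add_norm_sq_starProjection y
  rw [residual, ← Submodule.starProjection_orthogonal_val]
  nlinarith [sq_nonneg ‖T.starProjection y‖]

/-- If `A` is bounded below, then the projection onto its column space is controlled by `Aᵀ`. -/
lemma norm_sq_sub_le_residual {A : Matrix m κ ℝ} {l : ℝ} (hl : 0 < l)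
    (hA : ∀ c : κ → ℝ, l * (c ⬝ᵥ c) ≤ (A *ᵥ c) ⬝ᵥ (A *ᵥ c)) (y : EuclideanSpace ℝ m) :
    ‖y‖ ^ 2 - (Aᵀ *ᵥ y.ofLp) ⬝ᵥ (Aᵀ *ᵥ y.ofLp) / l ≤ residual (colSpan A) y := by
  have h := (colSpan A).norm_sq_eq_add_norm_sq_starProjection y
  rw [Submodule.starProjection_orthogonal_val] at h
  rw [residual]
  obtain ⟨c, hc⟩ := mem_colSpan_iff.1 ((colSpan A).starProjection_apply_mem y)
  set p := (colSpan A).starProjection y with hp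
  set b := Aᵀ *ᵥ y.ofLp with hb
  have hp2 : ‖p‖ ^ 2 = (A *ᵥ c) ⬝ᵥ (A *ᵥ c) := by
    rw [hc, EuclideanSpace.real_norm_sq_eq]
    simp [dotProduct, sq]
  have hpy : ‖p‖ ^ 2 = c ⬝ᵥ b := by
    have h1 : inner ℝ p y = ‖p‖ ^ 2 := by
      rw [← real_inner_self_eq_norm_sq p]
      nth_rewrite 2 [hp]
      rw [← Submodule.inner_starProjection_left_eq_right, ← hp, hp,
        Submodule.starProjection_eq_self_iff.2 ((colSpan A).starProjection_apply_mem y)]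
    rw [← h1, hb, dotProduct_mulVec, vecMul_transpose, hc, PiLp.inner_apply, dotProduct]
    exact Finset.sum_congr rfl fun i _ => by simp [mul_comm]
  have hcs : (c ⬝ᵥ b) ^ 2 ≤ (c ⬝ᵥ c) * (b ⬝ᵥ b) := by
    simpa [dotProduct, sq] using Finset.sum_mul_sq_le_sq_mul_sq Finset.univ c b
  have hb0 : 0 ≤ b ⬝ᵥ b := Finset.sum_nonneg fun _ _ => mul_self_nonneg _
  -- With `p = A c`: `‖p‖⁴ = (c ⬝ᵥ b)² ≤ (c ⬝ᵥ c) (b ⬝ᵥ b) ≤ ‖p‖² (b ⬝ᵥ b) / l`. Dividing by `‖p‖²`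
  -- requires `p ≠ 0`.
  have key : ‖p‖ ^ 2 ≤ b ⬝ᵥ b / l := by
    rw [le_div_iff₀ hl]
    rcases (sq_nonneg ‖p‖).eq_or_lt with h0 | h0
    · rw [← h0, zero_mul]; exact hb0
    · have h1 := hA c
      rw [← hp2] at h1
      rw [← hpy] at hcs
      refine le_of_mul_le_mul_left ?_ h0
      nlinarith [mul_le_mul_of_nonneg_right h1 hb0]
  linarith

end Residual

/-! ### From probabilities to counting. -/

section Law

variable {m : Type*} [Fintype m] [MeasurableSpace m]

lemma measureReal_uniformOn [MeasurableSingletonClass m] {Ω : Type*} [MeasurableSpace Ω]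
    {P : Measure Ω} {n : ℕ} {s : Ω → Fin n → m} (S : Finset (Fin n → m))
    (hs : HasLaw s (uniformOn (S : Set _)) P)
    (p : (Fin n → m) → Prop) [DecidablePred p] :
    P.real {ω | p (s ω)} = ((S.filter p).card : ℝ) / S.card := by
  classical
  have hm : {t | p t} = ((Finset.univ.filter p : Finset (Fin n → m)) : Set (Fin n → m)) := by
    ext t; simp
  rw [Measure.real, hs.measure_eq (Set.toFinite _).measurableSet, hm, uniformOn_apply_finset,
    ENNReal.toReal_div]
  have : S ∩ Finset.univ.filter p = S.filter p := by ext t; simp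
  simp [this]

/-- `uniformOn` of the empty set is the zero measure, which a probability measure excludes; an
injective sequence therefore exists in the second case and forces `n ≤ Fintype.card m`. -/
lemma IsUniformSampling.exists_sampleSpace {Ω : Type*} [MeasurableSpace Ω] {P : Measure Ω}
    [IsProbabilityMeasure P] {n : ℕ} {s : Ω → Fin n → m} (hs : IsUniformSampling s P) :
    ∃ S : Finset (Fin n → m), IsSampleSpace S ∧ S.Nonempty ∧
      HasLaw s (uniformOn (S : Set (Fin n → m))) P := by
  classical
  have hne : ∀ S : Finset (Fin n → m), HasLaw s (uniformOn (S : Set (Fin n → m))) P →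
      S.Nonempty := by
    intro S h
    rw [Finset.nonempty_iff_ne_empty]
    rintro rfl
    have h1 := h.measure_eq (p := fun _ => True) (by simp)
    simp at h1
  rcases hs with hs | hs
  · rw [← Finset.coe_univ] at hs
    exact ⟨_, Or.inl rfl, hne _ hs, hs⟩
  · have e : {t : Fin n → m | Function.Injective t} =
        ((Finset.univ.filter Function.Injective : Finset (Fin n → m)) : Set (Fin n → m)) := by
      ext t; simp
    rw [e] at hs
    obtain ⟨t, ht⟩ := hne _ hs
    refine ⟨_, Or.inr ⟨?_, by simp⟩, ⟨t, ht⟩, hs⟩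
    simpa using Fintype.card_le_of_injective t (Finset.mem_filter.1 ht).2

end Law

/-! ### The four exceptional events and the detector bounds. -/

section Detector

open Matrix

lemma samplingMatrix_mul_apply {m κ : Type*} [Fintype m] [DecidableEq m] {n : ℕ} (t : Fin n → m)
    (W : Matrix m κ ℝ) (i : Fin n) (k : κ) : (samplingMatrix t * W) i k = W (t i) k := by
  simp [samplingMatrix, mul_apply]

lemma sample_apply {m : Type*} [Fintype m] [DecidableEq m] {n : ℕ} (t : Fin n → m)
    (y : EuclideanSpace ℝ m) (i : Fin n) : sample (samplingMatrix t) y i = y (t i) := by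
  simp [sample, samplingMatrix, mulVec, dotProduct]

lemma sample_add {m : Type*} [Fintype m] {n : ℕ} (Θ : Matrix (Fin n) m ℝ)
    (x y : EuclideanSpace ℝ m) : sample Θ (x + y) = sample Θ x + sample Θ y := by
  simp [sample, mulVec_add]

lemma sample_mem_colSpan {m κ : Type*} [Fintype m] [Fintype κ] {n : ℕ} (Θ : Matrix (Fin n) m ℝ)
    {W : Matrix m κ ℝ} {x : EuclideanSpace ℝ m} (hx : x ∈ colSpan W) :
    sample Θ x ∈ colSpan (Θ * W) := by
  obtain ⟨c, rfl⟩ := mem_colSpan_iff.1 hx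
  exact mem_colSpan_iff.2 ⟨c, by simp [sample, mulVec_mulVec]⟩

lemma residual_colSpan_of_orthogonal {m κ : Type*} [Fintype m] [Fintype κ] {W : Matrix m κ ℝ}
    {y : EuclideanSpace ℝ m} (hy : Wᵀ *ᵥ y.ofLp = 0) : residual (colSpan W) y = ‖y‖ ^ 2 := by
  have : y ∈ (colSpan W)ᗮ := by
    rw [Submodule.mem_orthogonal]
    intro z hz
    induction hz using Submodule.span_induction with
    | mem z hz =>
      obtain ⟨k, rfl⟩ := hz
      simp only
      rw [inner_toLp_column, hy]
      rfl
    | zero => simp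
    | add a b _ _ ha hb => rw [inner_add_left, ha, hb, add_zero]
    | smul c a _ ha => rw [inner_smul_left, ha, mul_zero]
  rw [residual, (Submodule.starProjection_apply_eq_zero_iff _).2 this, sub_zero]

section Columns

variable {m ι : Type*} [Fintype m] [DecidableEq ι] {U : Matrix m ι ℝ}

lemma columns_transpose_mul_self (hU : Uᵀ * U = 1) (Δ : Finset ι) :
    (columns U Δ)ᵀ * columns U Δ = 1 := by
  ext k l
  refine (congrFun (congrFun hU k) l).trans ?_
  rw [one_apply, one_apply]
  exact if_congr Subtype.ext_iff.symm rfl rfl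

lemma columns_transpose_mulVec_of_mem_compl [Fintype ι] (hU : Uᵀ * U = 1) (Δ : Finset ι)
    {y : EuclideanSpace ℝ m} (hy : y ∈ colSpan (columns U Δᶜ)) :
    (columns U Δ)ᵀ *ᵥ y.ofLp = 0 := by
  obtain ⟨c, rfl⟩ := mem_colSpan_iff.1 hy
  have : (columns U Δ)ᵀ * columns U Δᶜ = 0 := by
    ext k l
    have h := congrFun (congrFun hU k) l
    have hkl : (k : ι) ≠ l := fun e => (Finset.mem_compl.1 l.2) (e ▸ k.2)
    simpa [columns, mul_apply, one_apply, hkl] using h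
  simp [mulVec_mulVec, this]

end Columns

variable {m κ : Type*} [Fintype m] [Fintype κ] [DecidableEq m] {W : Matrix m κ ℝ}

/-- The deterministic part of the lower bound on the residual of the sampled signal. -/
lemma le_residual_sample {n : ℕ} (t : Fin n → m) (y : EuclideanSpace ℝ m) {l : ℝ} (hl : 0 < l)
    (h : ∀ c : κ → ℝ, l * (c ⬝ᵥ c) ≤ ∑ i, (c ⬝ᵥ W (t i)) ^ 2) :
    ∑ i, y (t i) ^ 2 -
        ‖∑ i, y (t i) • (WithLp.toLp 2 (W (t i)) : EuclideanSpace ℝ κ)‖ ^ 2 / l ≤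
      residual (colSpan (samplingMatrix t * W)) (sample (samplingMatrix t) y) := by
  have h1 := norm_sq_sub_le_residual (A := samplingMatrix t * W) hl (fun c => by
    refine (h c).trans (le_of_eq ?_)
    simp only [dotProduct, mulVec, samplingMatrix_mul_apply, sq]
    simp only [mul_comm]) (sample (samplingMatrix t) y)
  refine le_trans (le_of_eq ?_) h1
  rw [EuclideanSpace.real_norm_sq_eq, EuclideanSpace.real_norm_sq_eq]
  simp only [sample_apply, dotProduct, mulVec, transpose_apply, samplingMatrix_mul_apply]
  congr 2
  refine Finset.sum_congr rfl fun k _ => ?_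
  simp [sq, mul_comm]

variable [DecidableEq κ]

/-- The detector bounds for a signal orthogonal to the subspace fail for at most the fraction `4 ε`
of the samples. -/
lemma IsSampleSpace.card_filter_not_residual_bounds_le [Nonempty m] [Nonempty κ] {n : ℕ}
    {S : Finset (Fin n → m)} (hS : IsSampleSpace S) (hW : Wᵀ * W = 1) (y : EuclideanSpace ℝ m)
    (hy : Wᵀ *ᵥ y.ofLp = 0) {ε μ α β γ δ : ℝ} (hε : 0 < ε) (hε1 : ε < 1)
    (hμ : μ = coherence (colSpan W))
    (hn : (n : ℝ) ≥ 8 / 3 * Fintype.card κ * μ * Real.log (2 * Fintype.card κ / ε))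
    (hδ : δ = √(8 * Fintype.card κ * μ / (3 * n) * Real.log (2 * Fintype.card κ / ε)))
    (hγ : γ = √(2 * vecCoherence y * Real.log (1 / ε)))
    (hβ : β = √(2 * vecCoherence y ^ 2 / n * Real.log (1 / ε)))
    (hα : α = (n * (1 - β) - Fintype.card κ * μ * ((1 + γ) ^ 2 / (1 - δ))) / Fintype.card m)
    (good : (Fin n → m) → Prop) [DecidablePred good]
    (hgood : ∀ t, good t ↔
      (δ < 1 → α * ‖y‖ ^ 2 ≤
        residual (colSpan (samplingMatrix t * W)) (sample (samplingMatrix t) y)) ∧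
      residual (colSpan (samplingMatrix t * W)) (sample (samplingMatrix t) y) ≤
        (1 + β) * (n / Fintype.card m) * ‖y‖ ^ 2) :
    ((S.filter fun t => ¬ good t).card : ℝ) ≤ 4 * ε * S.card := by
  classical
  set N : ℝ := (Fintype.card m : ℝ) with hN
  have hN0 : 0 < N := by rw [hN]; exact_mod_cast Fintype.card_pos
  set r : ℝ := (Fintype.card κ : ℝ) with hr
  have hr1 : 1 ≤ r := by rw [hr]; exact_mod_cast Fintype.card_pos
  have hμ0 : 0 < μ := hμ ▸ coherence_colSpan_pos hW
  have hL2 : 0 < Real.log (2 * r / ε) := Real.log_pos (by rw [lt_div_iff₀ hε]; linarith)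
  have hL : 0 < Real.log (1 / ε) := Real.log_pos (by rw [lt_div_iff₀ hε]; linarith)
  have hn0 : 0 < (n : ℝ) := lt_of_lt_of_le (by positivity) hn
  have hn1 : 0 < n := by exact_mod_cast hn0
  have hexp : Real.exp (-Real.log (1 / ε)) = ε := by
    rw [one_div, Real.log_inv, neg_neg, Real.exp_log hε]
  -- For `y = 0` every residual vanishes; otherwise the coherence of `y` is positive and may be
  -- divided by.
  rcases eq_or_ne y 0 with rfl | hy0
  · have hall : ∀ t, good t := by
      intro t
      have h0 : sample (samplingMatrix t) (0 : EuclideanSpace ℝ m) = 0 := by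
        ext i; simp [sample_apply]
      rw [hgood, h0]
      simp [residual]
    simp only [hall, not_true_eq_false, Finset.filter_false, Finset.card_empty, Nat.cast_zero]
    positivity
  set ν : ℝ := vecCoherence y with hνdef
  have hν : 0 < ν := vecCoherence_pos hy0
  have hG : 0 < ‖y‖ ^ 2 := by positivity
  set G : ℝ := ‖y‖ ^ 2 with hGdef
  have hyG : ∑ a, y a ^ 2 = G := (EuclideanSpace.real_norm_sq_eq y).symm
  have hyν : ∀ a, y a ^ 2 ≤ ν / N * G := fun a => sq_le_vecCoherence hy0 a
  set R : ℝ := r * μ / N with hRdef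
  have hR0 : 0 < R := by positivity
  have hR : ∀ a, W a ⬝ᵥ W a ≤ R := by
    intro a
    have := row_dotProduct_le_coherence hW a
    rwa [← hμ] at this
  have hβ0 : 0 ≤ β := hβ ▸ Real.sqrt_nonneg _
  have hγ0 : 0 ≤ γ := hγ ▸ Real.sqrt_nonneg _
  have hδ0 : 0 ≤ δ := hδ ▸ Real.sqrt_nonneg _
  have hβ2 : β ^ 2 = 2 * ν ^ 2 / n * Real.log (1 / ε) := by
    rw [hβ, Real.sq_sqrt (by positivity)]
  have hγ2 : γ ^ 2 = 2 * ν * Real.log (1 / ε) := by rw [hγ, Real.sq_sqrt (by positivity)]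
  have hδ2 : δ ^ 2 = 8 * r * μ / (3 * n) * Real.log (2 * r / ε) := by
    rw [hδ, Real.sq_sqrt (by positivity)]
  set w : m → EuclideanSpace ℝ κ := fun a => WithLp.toLp 2 (W a) with hw
  let tooLarge : (Fin n → m) → Prop := fun t => (1 + β) * (n / N) * G ≤ ∑ i, y (t i) ^ 2
  let tooSmall : (Fin n → m) → Prop := fun t => ∑ i, y (t i) ^ 2 ≤ (1 - β) * (n / N) * G
  let correlated : (Fin n → m) → Prop := fun t =>
    (1 + γ) ^ 2 * (n / N * R * G) ≤ ‖∑ i, y (t i) • w (t i)‖ ^ 2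
  let illConditioned : (Fin n → m) → Prop := fun t => ∃ c : κ → ℝ,
    ∑ i, (c ⬝ᵥ W (t i)) ^ 2 < (1 - δ) * (n / N) * (c ⬝ᵥ c)
  -- The exponent equals `4 * log (1 / ε)`, so `β` leaves room: each energy tail is in fact at most
  -- `ε ^ 4`.
  have hexp4 : Real.exp (-(2 * β ^ 2 * n / ν ^ 2)) ≤ ε := by
    refine le_trans (Real.exp_le_exp.2 ?_) hexp.le
    have : 2 * β ^ 2 * n / ν ^ 2 = 4 * Real.log (1 / ε) := by
      rw [hβ2]; field_simp; ring
    linarith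
  have h₁ : ((S.filter tooLarge).card : ℝ) ≤ ε * S.card :=
    (hS.card_filter_energy_gt_le hn1 (fun a => y a ^ 2) hG hyG hν (fun _ => sq_nonneg _) hyν hβ0
      tooLarge fun t ht => ht).trans (by gcongr)
  have h₂ : ((S.filter tooSmall).card : ℝ) ≤ ε * S.card :=
    (hS.card_filter_energy_lt_le hn1 (fun a => y a ^ 2) hG hyG hν (fun _ => sq_nonneg _) hyν hβ0
      tooSmall fun t ht => ht).trans (by gcongr)
  have h₃ : ((S.filter correlated).card : ℝ) ≤ ε * S.card := by
    have := hS.card_filter_norm_gt_le hn1 (fun a => y a) w (by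
        ext k
        have := congrFun hy k
        simpa [hw, mulVec, dotProduct, mul_comm] using this) hG hyG hν hyν hR0 (fun a => by
        refine le_trans (le_of_eq ?_) (hR a)
        rw [EuclideanSpace.real_norm_sq_eq]
        simp [hw, dotProduct, sq]) hγ0 correlated fun t ht => ht
    have e : γ ^ 2 / (2 * ν) = Real.log (1 / ε) := by rw [hγ2]; field_simp
    rwa [e, hexp] at this
  have h₄ : ((S.filter illConditioned).card : ℝ) ≤ ε * S.card := by
    have := hS.card_filter_quadForm_lt_le (fun a => W a) (sum_vecMulVec_rows hW) hR0 hR hδ0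
        illConditioned (by
      rintro t ⟨c, hc⟩
      have hc0 : 0 < c ⬝ᵥ c := by
        refine (dotProduct_star_self_pos_iff (v := c)).2 ?_
        rintro rfl
        simp at hc
      -- Strictness in `illConditioned` rules out `c = 0`, so `c` can be normalized.
      refine ⟨(√(c ⬝ᵥ c))⁻¹ • c, ?_, ?_⟩
      · rw [smul_dotProduct, dotProduct_smul, smul_eq_mul, smul_eq_mul, ← mul_assoc, ← mul_inv,
          Real.mul_self_sqrt hc0.le, inv_mul_cancel₀ hc0.ne']
      · simp only [smul_dotProduct, smul_eq_mul, mul_pow, inv_pow, Real.sq_sqrt hc0.le,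
          ← Finset.mul_sum]
        rw [inv_mul_le_iff₀ hc0]
        linarith)
    have e : 3 / 8 * δ ^ 2 * (n / (N * R)) = Real.log (2 * r / ε) := by
      rw [hδ2, hRdef]; field_simp
    -- Times the dimension factor `r`, this gives `ε / 2`.
    have e2 : Real.exp (-Real.log (2 * r / ε)) = ε / (2 * r) := by
      rw [← Real.log_inv, inv_div, Real.exp_log (by positivity)]
    rw [← hN, ← hr, e, e2] at this
    refine this.trans ?_
    gcongr
    rw [mul_div_assoc', div_le_iff₀ (by positivity)]
    nlinarith
  have hsub : S.filter (fun t => ¬ good t) ⊆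
      S.filter tooLarge ∪ S.filter tooSmall ∪ S.filter correlated ∪ S.filter illConditioned := by
    intro t ht
    rw [Finset.mem_filter] at ht
    simp only [Finset.mem_union, Finset.mem_filter, ht.1, true_and]
    by_contra hnot
    push Not at hnot
    obtain ⟨⟨⟨n₁, n₂⟩, n₃⟩, n₄⟩ := hnot
    simp only [tooLarge, tooSmall, correlated, illConditioned, not_le, not_exists,
      not_lt] at n₁ n₂ n₃ n₄
    refine ht.2 ((hgood t).2 ⟨fun hδ1 => ?_, ?_⟩)
    · have hδ' : 0 < 1 - δ := by linarith
      have hl : 0 < (1 - δ) * (n / N) := by positivity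
      refine le_trans ?_ (le_residual_sample t y hl n₄)
      have h5 : ‖∑ i, y (t i) • w (t i)‖ ^ 2 / ((1 - δ) * (n / N)) ≤
          (1 + γ) ^ 2 * (n / N * R * G) / ((1 - δ) * (n / N)) := by gcongr
      have h6 : α * G = (1 - β) * (n / N) * G -
          (1 + γ) ^ 2 * (n / N * R * G) / ((1 - δ) * (n / N)) := by
        rw [hα, hRdef]
        field_simp
      rw [h6]
      linarith
    · refine (residual_le_norm_sq _ _).trans ?_
      rw [EuclideanSpace.real_norm_sq_eq]
      simp only [sample_apply]
      exact n₁.le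
  have hcard : ((S.filter fun t => ¬ good t).card : ℝ) ≤ (S.filter tooLarge).card +
      (S.filter tooSmall).card + (S.filter correlated).card + (S.filter illConditioned).card := by
    refine le_trans (Nat.cast_le.2 (Finset.card_le_card hsub)) ?_
    exact_mod_cast (Finset.card_union_le _ _).trans (Nat.add_le_add_right
      ((Finset.card_union_le _ _).trans (Nat.add_le_add_right (Finset.card_union_le _ _) _)) _)
  linarith

end Detector

end TopologicalDetector

/-! ### The theorem: reduction to the orthogonal component and passage to the law of the samples. -/

open TopologicalDetector in
theorem mainTheorem1 {V : Type*} [Fintype V] [LinearOrder V] (K : AbstractSimplicialComplex V)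
    (N : ℕ) (hN : N = Fintype.card (Simplex K))
    -- the eigenvectors of the Dirac operator, and those that span the subspace of interest
    (U : Matrix (Simplex K) (Fin (Fintype.card (Simplex K))) ℝ)
    (ev : Fin (Fintype.card (Simplex K)) → ℝ) (hU : IsDiracEigenbasis K U ev)
    (Δ : Finset (Fin (Fintype.card (Simplex K)))) (hΔ : Δ.Nonempty)
    -- the signal and its decomposition
    (x xΔ xΔc : EuclideanSpace ℝ (Simplex K)) (hx : x = xΔ + xΔc)
    (hxΔ : xΔ ∈ colSpan (columns U Δ)) (hxΔc : xΔc ∈ colSpan (columns U Δᶜ))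
    -- the random sampling
    {Ω : Type*} [MeasurableSpace Ω] (P : MeasureTheory.Measure Ω)
    [MeasureTheory.IsProbabilityMeasure P] (No : ℕ) (s : Ω → Fin No → Simplex K)
    (hs : IsUniformSampling s P)
    -- the constants
    (ε : ℝ) (hε : 0 < ε) (μ α β γ δ : ℝ)
    (hμ : μ = coherence (colSpan (columns U Δ)))
    (hNo : (No : ℝ) ≥ 8 / 3 * Δ.card * μ * Real.log (2 * Δ.card / ε))
    (hδ : δ = Real.sqrt (8 * Δ.card * μ / (3 * No) * Real.log (2 * Δ.card / ε)))
    (hγ : γ = Real.sqrt (2 * vecCoherence xΔc * Real.log (1 / ε)))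
    (hβ : β = Real.sqrt (2 * vecCoherence xΔc ^ 2 / No * Real.log (1 / ε)))
    (hα : α = (No * (1 - β) - Δ.card * μ * ((1 + γ) ^ 2 / (1 - δ))) / N) :
    -- `δ ≤ 1`, and `α` is undefined (in the limit `-∞`) if `δ = 1`
    P.real {ω |
      (δ < 1 →
        α * residual (colSpan (columns U Δ)) x ≤
          residual (colSpan (samplingMatrix (s ω) * columns U Δ))
            (sample (samplingMatrix (s ω)) x)) ∧
      residual (colSpan (samplingMatrix (s ω) * columns U Δ))
          (sample (samplingMatrix (s ω)) x) ≤
        (1 + β) * (No / N) * residual (colSpan (columns U Δ)) x} ≥ 1 - 4 * ε := by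
  classical
  have hΔne : Nonempty Δ := hΔ.to_subtype
  obtain ⟨k, -⟩ := hΔ
  have hne : Nonempty (Simplex K) := Fintype.card_pos_iff.1 k.pos
  have : MeasurableSingletonClass (Simplex K) := ⟨fun _ => trivial⟩
  -- For `ε ≥ 1 / 4` the claimed probability is at most `0`; below that, `ε < 1` makes the
  -- logarithms positive.
  rcases le_or_gt (1 / 4) ε with hε4 | hε4
  · exact le_trans (by linarith) measureReal_nonneg
  set W := columns U Δ with hWdef
  have hW : W.transpose * W = 1 := columns_transpose_mul_self hU.orthonormal Δ
  have hy : W.transpose.mulVec xΔc.ofLp = 0 :=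
    columns_transpose_mulVec_of_mem_compl hU.orthonormal Δ hxΔc
  have hres : residual (colSpan W) x = ‖xΔc‖ ^ 2 := by
    rw [hx, residual_add_of_mem _ hxΔ, residual_colSpan_of_orthogonal hy]
  have hress : ∀ t : Fin No → Simplex K,
      residual (colSpan (samplingMatrix t * W)) (sample (samplingMatrix t) x) =
        residual (colSpan (samplingMatrix t * W)) (sample (samplingMatrix t) xΔc) := by
    intro t
    rw [hx, sample_add, residual_add_of_mem _ (sample_mem_colSpan _ hxΔ)]
  obtain ⟨S, hS, hSne, hlaw⟩ := hs.exists_sampleSpace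
  let good : (Fin No → Simplex K) → Prop := fun t =>
    (δ < 1 → α * ‖xΔc‖ ^ 2 ≤
      residual (colSpan (samplingMatrix t * W)) (sample (samplingMatrix t) xΔc)) ∧
    residual (colSpan (samplingMatrix t * W)) (sample (samplingMatrix t) xΔc) ≤
      (1 + β) * (No / Fintype.card (Simplex K)) * ‖xΔc‖ ^ 2
  have hcard : (Δ.card : ℝ) = Fintype.card Δ := by rw [Fintype.card_coe]
  rw [hcard] at hNo hδ hα
  rw [hN] at hα
  have hbad := hS.card_filter_not_residual_bounds_le hW xΔc hy hε (by linarith) hμ hNo hδ hγ hβ hα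
    good fun t => Iff.rfl
  simp only [hres, hress, hN]
  have hP := measureReal_uniformOn S hlaw good
  have hS0 : 0 < (S.card : ℝ) := by exact_mod_cast hSne.card_pos
  have hsplit : ((S.filter good).card : ℝ) + (S.filter fun t => ¬ good t).card = S.card := by
    exact_mod_cast Finset.card_filter_add_card_filter_not (s := S) good
  refine le_trans ?_ (le_of_eq hP.symm)
  rw [le_div_iff₀ hS0]
  linarith
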